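/- **Theorem 2.** Let $V=\{1,\dots,p\}$ and $\alpha(i)\ge 2$ for $i\in V$. Let $Y_k=(Y_k^{(1)},\dots,Y_k^{(p)})\in\{0,1\}^p$, $k=1,2,\dots$, be a stationary ergodic source, and let $X_k=(X_k^{(1)},\dots,X_k^{(p)})$ be random vectors with $X_k^{(i)}\in\{0,\dots,\alpha(i)-1\}$ if $Y_k^{(i)}=1$ and $X_k^{(i)}=\alpha(i)$ ("missing") if $Y_k^{(i)}=0$. Assume that, given the sequence $Y$, the $X_k$ are independent and the law of $X_k$ depends only on $Y_k$, in the same way for all $k$. Write $(X,Y)$ for a generic $(X_k,Y_k)$. Let $r(i)=P(Y^{(i)}=1)$, $r(i,j)=P(Y^{(i)}=Y^{(j)}=1)$; let $P_i$ be the law of $X^{(i)}$ given $Y^{(i)}=1$, with entropy $H(i)$, and $P_{ij}$ the law of $(X^{(i)},X^{(j)})$ given $Y^{(i)}=Y^{(j)}=1$, with mutual information $I(i,j)$. For weights $w(i,j)=w(j,i)$, the Chow–Liu algorithm examines all pairs $\{i,j\}$, $i\ne j$, in an order of non-increasing weight (ties broken arbitrarily) and connects a pair if its weight is positive and no loop is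 created. Let $E_{X|Y}$ be an edge set obtained by applying it to $\{r(i,j)I(i,j)\}$. Assume that for each $i\in V$ the law of $X^{(i)}$ given $Y=y$ is the same for all $y$ with $y_i=1$ and $P(Y=y)>0$, and that for each $\{i,j\}\in E_{X|Y}$ the law of $(X^{(i)},X^{(j)})$ given $Y=y$ is the same for all $y$ with $y_i=y_j=1$ and $P(Y=y)>0$ (as is the case if values are missing independently of the data). Put $$P'_{X|Y}(x|y)=\prod_{i\in V}P_i(x_i)^{y_i}\prod_{\{i,j\}\in E_{X|Y}}\Big\{\frac{P_{ij}(x_i,x_j)}{P_i(x_i)P_j(x_j)}\Big\}^{y_iy_j},\qquad H(X|Y)=-\sum_yP(Y=y)\sum_xP'_{X|Y}(x|y)\log P'_{X|Y}(x|y),$$ where $x$ ranges over the samples whose missing entries are exactly those with $y_i=0$. For a data frame $X_1,\dots,X_n$, let $[i]$ and $[i,j]$ be the sets of $k\le n$ for which entry $i$, respectively both entries $i$ and $j$, are not missing, and $n(i)$, $n(i,j)$ their cardinalities. For a sequence over an alphabet $A$ in which $a\in A$ occurs $c(a)$ times, the Bayes measure is $$\frac{\Gamma(|A|/2)}{\Gamma\big(\sum_{a}(c(a)+\frac12)\big)}\prod_{a\in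 A}\frac{\Gamma(c(a)+\frac12)}{\Gamma(\frac12)}.$$ Let $Q^n(i)$, $Q^n_j(i)$, $Q^n(i,j)$ be the Bayes measures of $\{X_k^{(i)}\}_{k\in[i]}$, $\{X_k^{(i)}\}_{k\in[i,j]}$, $\{(X_k^{(i)},X_k^{(j)})\}_{k\in[i,j]}$, and let $$J^n(i,j)=\frac1n\log\frac{Q^n(i,j)}{Q^n_j(i)Q^n_i(j)},\qquad R^n(E)=\prod_{i\in V}Q^n(i)\prod_{\{i,j\}\in E}\frac{Q^n(i,j)}{Q^n_j(i)Q^n_i(j)}.$$ Let $E'$ be an edge set obtained by applying the Chow–Liu algorithm to $\{J^n(i,j)\}$, and let $L=\log F_p-\log R^n(E')$ be the description length based on it, where $F_p$ is the number of forests on $V$. Then $$H(X|Y)=\sum_{i\in V}r(i)H(i)-\sum_{\{i,j\}\in E_{X|Y}}r(i,j)I(i,j),$$ and the per-sample redundancy satisfies, for all $n\ge1$, $$\frac{EL}{n}-H(X|Y)\le\sum_{i\in V}\frac{\alpha(i)-1}{2n}E\log n(i)+\sum_{\{i,j\}\in E_{X|Y}}\frac{(\alpha(i)-1)(\alpha(j)-1)}{2n}E\log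 n(i,j)+O(1/n),$$ where the constant in $O(1/n)$ does not depend on $n$, and $\log 0$ is read as $0$. -/

import Mathlib

open MeasureTheory ProbabilityTheory

namespace ForestCoding

/-! ### Forests and the Chow–Liu (Kruskal) procedure

The vertex set is `Fin p`; an undirected edge `{i, j}` is represented by the pair `(i, j)` with
`i < j`. -/

/-- The undirected graph on `Fin p` whose edge set is `E`. -/
def graphOf {p : ℕ} (E : Finset (Fin p × Fin p)) : SimpleGraph (Fin p) :=
  SimpleGraph.fromRel fun i j => (i, j) ∈ E

/-- `E` is the edge set of a forest. -/
def IsForest {p : ℕ} (E : Finset (Fin p × Fin p)) : Prop :=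
  (∀ e ∈ E, e.1 < e.2) ∧ (graphOf E).IsAcyclic

open Classical in
/-- One step of the procedure: the pair `e` is connected if its weight is positive and
connecting it creates no loop. -/
noncomputable def kruskalStep {p : ℕ} (w : Fin p → Fin p → ℝ)
    (E : Finset (Fin p × Fin p)) (e : Fin p × Fin p) : Finset (Fin p × Fin p) :=
  if 0 < w e.1 e.2 ∧ (graphOf (insert e E)).IsAcyclic then insert e E else E

/-- `E` is an edge set obtained by applying the Chow–Liu algorithm to the weights `w`: all pairs
are examined once, in an order of non-increasing weight (ties are broken arbitrarily). -/
def IsChowLiu {p : ℕ} (w : Fin p → Fin p → ℝ) (E : Finset (Fin p × Fin p)) : Prop :=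
  ∃ l : List (Fin p × Fin p), l.Nodup ∧ (∀ e, e ∈ l ↔ e.1 < e.2) ∧
    l.Pairwise (fun e f => w f.1 f.2 ≤ w e.1 e.2) ∧ E = l.foldl (kruskalStep w) ∅

open Classical in
/-- The number of forests with vertex set `Fin p`. -/
noncomputable def numForests (p : ℕ) : ℕ :=
  (Finset.univ.filter fun E : Finset (Fin p × Fin p) => IsForest E).card

/-! ### Data frames with missing values, Bayes measures and the description length -/

/-- A sample of the `p` variables: the `i`-th entry is one of the values `0, …, α i - 1`, or
`α i` (that is, `Fin.last (α i)`), which means that the entry is missing. -/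
abbrev Row {p : ℕ} (α : Fin p → ℕ) : Type := (i : Fin p) → Fin (α i + 1)

section Frame

variable {p : ℕ} {α : Fin p → ℕ} {n : ℕ}

/-- `[i]`: the samples in which entry `i` is not missing. -/
def obs (x : Fin n → Row α) (i : Fin p) : Finset (Fin n) :=
  Finset.univ.filter fun k => x k i ≠ Fin.last (α i)

/-- `[i,j]`: the samples in which neither entry `i` nor entry `j` is missing. -/
def obs₂ (x : Fin n → Row α) (i j : Fin p) : Finset (Fin n) :=
  Finset.univ.filter fun k => x k i ≠ Fin.last (α i) ∧ x k j ≠ Fin.last (α j)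

/-- The Bayes measure with all prior parameters equal to `1/2` of a sequence over the finite
alphabet `A` in which each `a` occurs `c a` times. -/
noncomputable def bayesMeasure {A : Type*} [Fintype A] (c : A → ℕ) : ℝ :=
  Real.Gamma ((Fintype.card A : ℝ) / 2) / Real.Gamma (∑ a, ((c a : ℝ) + 1 / 2)) *
    ∏ a, (Real.Gamma ((c a : ℝ) + 1 / 2) / Real.Gamma (1 / 2))

/-- `Qⁿ(i)`: Bayes measure of the `i`-th entries over `[i]`. -/
noncomputable def Q (x : Fin n → Row α) (i : Fin p) : ℝ :=
  bayesMeasure fun a : Fin (α i) => ((obs x i).filter fun k => x k i = a.castSucc).card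

/-- `Qⁿ_j(i)`: Bayes measure of the `i`-th entries over `[i,j]`. -/
noncomputable def Qsub (x : Fin n → Row α) (i j : Fin p) : ℝ :=
  bayesMeasure fun a : Fin (α i) => ((obs₂ x i j).filter fun k => x k i = a.castSucc).card

/-- `Qⁿ(i,j)`: Bayes measure of the pairs of `i`-th and `j`-th entries over `[i,j]`. -/
noncomputable def Qpair (x : Fin n → Row α) (i j : Fin p) : ℝ :=
  bayesMeasure fun ab : Fin (α i) × Fin (α j) =>
    ((obs₂ x i j).filter fun k => x k i = ab.1.castSucc ∧ x k j = ab.2.castSucc).card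

/-- `Jⁿ(i,j)`. -/
noncomputable def J (x : Fin n → Row α) (i j : Fin p) : ℝ :=
  1 / (n : ℝ) * Real.log (Qpair x i j / (Qsub x i j * Qsub x j i))

/-- `Rⁿ(E)`: Bayes measure of the data frame with respect to the forest `E`. -/
noncomputable def R (x : Fin n → Row α) (E : Finset (Fin p × Fin p)) : ℝ :=
  (∏ i, Q x i) * ∏ e ∈ E, Qpair x e.1 e.2 / (Qsub x e.1 e.2 * Qsub x e.2 e.1)

/-- Description length (in nats) of the data frame through the forest `E`, under the uniform prior
over the forests: `log (number of forests)` for the forest, `-log Rⁿ(E)` for the data. -/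
noncomputable def descriptionLength (x : Fin n → Row α) (E : Finset (Fin p × Fin p)) : ℝ :=
  Real.log (numForests p) - Real.log (R x E)

end Frame

/-! ### The source -/

section Source

variable {p : ℕ} {α : Fin p → ℕ} {Ω : Type*} [MeasurableSpace Ω]

/-- `Y` is a stationary ergodic source of indicators (`true` = observed) and `X` a data source
whose missing entries are those indicated by `Y`. Given the sequence `Y`, the samples `X k` are
independent, and the law of `X k` is determined by `Y k`, in the same way for all `k`. -/
structure IsIncompleteSource (μ : Measure Ω) (X : ℕ → Ω → Row α)
    (Y : ℕ → Ω → Fin p → Bool) : Prop where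
  measurable_X : ∀ k, Measurable (X k)
  measurable_Y : ∀ k, Measurable (Y k)
  missing_iff : ∀ k ω i, X k ω i = Fin.last (α i) ↔ Y k ω i = false
  ergodic : Ergodic (fun (y : ℕ → Fin p → Bool) (k : ℕ) => y (k + 1))
    (μ.map fun ω k => Y k ω)
  memoryless : ∀ (n : ℕ) (x : Fin n → Row α) (y : Fin n → Fin p → Bool),
    μ.real {ω | ∀ k : Fin n, X k ω = x k ∧ Y k ω = y k} =
      μ.real {ω | ∀ k : Fin n, Y k ω = y k} *
        ∏ k : Fin n, (μ[|{ω | Y 0 ω = y k}]).real {ω | X 0 ω = x k}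

variable (μ : Measure Ω) (X : ℕ → Ω → Row α) (Y : ℕ → Ω → Fin p → Bool)

/-- `r(i)`: probability that entry `i` is observed. -/
noncomputable def r (i : Fin p) : ℝ := μ.real {ω | Y 0 ω i = true}

/-- `r(i,j)`: probability that entries `i` and `j` are both observed. -/
noncomputable def r₂ (i j : Fin p) : ℝ := μ.real {ω | Y 0 ω i = true ∧ Y 0 ω j = true}

/-- `P(X⁽ⁱ⁾ = a)`, the law of entry `i` given that it is observed. -/
noncomputable def P (i : Fin p) (a : Fin (α i + 1)) : ℝ :=
  (μ[|{ω | Y 0 ω i = true}]).real {ω | X 0 ω i = a}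

/-- The law of entry `i` given that entries `i` and `j` are both observed. -/
noncomputable def Psub (i j : Fin p) (a : Fin (α i + 1)) : ℝ :=
  (μ[|{ω | Y 0 ω i = true ∧ Y 0 ω j = true}]).real {ω | X 0 ω i = a}

/-- `P(X⁽ⁱ⁾ = a, X⁽ʲ⁾ = b)`, the law of entries `i`, `j` given that both are observed. -/
noncomputable def P₂ (i j : Fin p) (a : Fin (α i + 1)) (b : Fin (α j + 1)) : ℝ :=
  (μ[|{ω | Y 0 ω i = true ∧ Y 0 ω j = true}]).real {ω | X 0 ω i = a ∧ X 0 ω j = b}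

/-- The law of entries `i` and `j`, when both are observed, does not depend on which of the other
entries are observed. For `i = j` this is a condition on the law of the single entry `i`. -/
def PatternFree (i j : Fin p) : Prop :=
  ∀ y : Fin p → Bool, y i = true → y j = true → μ {ω | Y 0 ω = y} ≠ 0 →
    ∀ (a : Fin (α i + 1)) (b : Fin (α j + 1)),
      (μ[|{ω | Y 0 ω = y}]).real {ω | X 0 ω i = a ∧ X 0 ω j = b} = P₂ μ X Y i j a b

/-- `H(i)`: entropy of the observed entry `i`. -/
noncomputable def H (i : Fin p) : ℝ := ∑ a, Real.negMulLog (P μ X Y i a)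

/-- `I(i,j)`: mutual information of entries `i` and `j` when both are observed. -/
noncomputable def I (i j : Fin p) : ℝ :=
  ∑ a, ∑ b, P₂ μ X Y i j a b *
    Real.log (P₂ μ X Y i j a b / (Psub μ X Y i j a * Psub μ X Y j i b))

/-- The forest distribution `P'(x | y)` of a sample given its missingness pattern. -/
noncomputable def P' (E : Finset (Fin p × Fin p)) (x : Row α) (y : Fin p → Bool) : ℝ :=
  (∏ i, P μ X Y i (x i) ^ (y i).toNat) *
    ∏ e ∈ E, (P₂ μ X Y e.1 e.2 (x e.1) (x e.2) /
      (P μ X Y e.1 (x e.1) * P μ X Y e.2 (x e.2))) ^ ((y e.1).toNat * (y e.2).toNat)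

open Classical in
/-- `H(X|Y)`: the conditional entropy of `P'` given the missingness pattern. The inner sum is over
the samples whose missing entries are those indicated by `y`. -/
noncomputable def condEntropy (E : Finset (Fin p × Fin p)) : ℝ :=
  ∑ y : Fin p → Bool, μ.real {ω | Y 0 ω = y} *
    ∑ x ∈ Finset.univ.filter (fun x : Row α => ∀ i, x i = Fin.last (α i) ↔ y i = false),
      Real.negMulLog (P' μ X Y E x y)

/-- The data frame of the first `n` samples. -/
def frame (n : ℕ) (ω : Ω) : Fin n → Row α := fun k => X k ω

end Source

end ForestCoding

/-!
The Chow–Liu algorithm is Kruskal's: by matroid exchange, the forest it builds from `Jⁿ` maximizes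
`Rⁿ` among all forests, so its description length is at most that of the fixed forest `E_{X|Y}`.
For a fixed forest, Stirling's formula turns `-log` of each Bayes measure over an alphabet `A` into
the empirical code length plus `(|A| - 1) / 2` times the log of the sample size, up to `O(1)`.
Given `Y`, a symbol count `N` is a sum of independent indicators, so `Var N ≤ E N`; this makes
`E (-N log N)` differ from `-E N log E N` by at most `1`, and the mean empirical code length from
the corresponding entropy by `O(1)`. For an edge the sample-size coefficients combine to
`(α i α j - 1) - (α i - 1) - (α j - 1) = (α i - 1) (α j - 1)`. Finally, `P'(· | y)` has the
prescribed vertex and edge marginals because `E_{X|Y}` has no cycle, which gives the entropy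
formula.
-/

namespace ForestCoding

section Kruskal

variable {p : ℕ}

theorem graphOf_adj {E : Finset (Fin p × Fin p)} {a b : Fin p} :
    (graphOf E).Adj a b ↔ a ≠ b ∧ ((a, b) ∈ E ∨ (b, a) ∈ E) := by
  simp [graphOf, SimpleGraph.fromRel_adj]

theorem graphOf_mono {E F : Finset (Fin p × Fin p)} (h : E ⊆ F) : graphOf E ≤ graphOf F := by
  intro a b hab
  rw [graphOf_adj] at hab ⊢
  exact ⟨hab.1, hab.2.imp (@h _) (@h _)⟩

theorem graphOf_insert (e : Fin p × Fin p) (E : Finset (Fin p × Fin p)) :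
    graphOf (insert e E) = graphOf E ⊔ SimpleGraph.edge e.1 e.2 := by
  ext a b
  obtain ⟨i, j⟩ := e
  simp only [SimpleGraph.sup_adj, graphOf_adj, SimpleGraph.edge_adj, Finset.mem_insert,
    Prod.mk.injEq]
  tauto

theorem graphOf_empty : graphOf (∅ : Finset (Fin p × Fin p)) = ⊥ := by
  ext a b
  simp [graphOf_adj]

theorem IsForest.empty : IsForest (∅ : Finset (Fin p × Fin p)) := by
  refine ⟨by simp, ?_⟩
  rw [graphOf_empty]
  exact SimpleGraph.isAcyclic_bot

theorem IsForest.subset {E F : Finset (Fin p × Fin p)} (hF : IsForest F) (h : E ⊆ F) :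
    IsForest E :=
  ⟨fun e he => hF.1 e (h he), hF.2.anti (graphOf_mono h)⟩

theorem IsForest.not_reachable_of_insert {E : Finset (Fin p × Fin p)} {e : Fin p × Fin p}
    (h : IsForest (insert e E)) (he : e ∉ E) : ¬ (graphOf E).Reachable e.1 e.2 := by
  obtain ⟨hlt, hE⟩ := (Finset.forall_mem_insert _ _ _).1 h.1
  have hac := h.2
  rw [graphOf_insert, SimpleGraph.isAcyclic_sup_fromEdgeSet_iff] at hac
  intro hr
  rcases hac.2 hr with heq | hadj
  · exact hlt.ne heq
  · exact (graphOf_adj.1 hadj).2.elim he fun hswap => hlt.asymm (hE _ hswap)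

theorem IsForest.insert_of_not_reachable {E : Finset (Fin p × Fin p)} {e : Fin p × Fin p}
    (h : IsForest E) (hlt : e.1 < e.2) (hr : ¬ (graphOf E).Reachable e.1 e.2) :
    IsForest (insert e E) := by
  refine ⟨(Finset.forall_mem_insert _ _ _).2 ⟨hlt, h.1⟩, ?_⟩
  rw [graphOf_insert]
  exact h.2.sup_edge_of_not_reachable hr

theorem exists_mem_of_mem_edgeSet_graphOf {E : Finset (Fin p × Fin p)} {s : Sym2 (Fin p)}
    (hs : s ∈ (graphOf E).edgeSet) : ∃ f ∈ E, s(f.1, f.2) = s := by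
  induction s with
  | h a b =>
    rcases (graphOf_adj.1 hs).2 with h | h
    exacts [⟨_, h, rfl⟩, ⟨_, h, Sym2.eq_swap⟩]

theorem IsForest.not_reachable_erase {F : Finset (Fin p × Fin p)} (hF : IsForest F)
    {f : Fin p × Fin p} (hf : f ∈ F) {u v : Fin p} {w : (graphOf F).Walk u v} (hw : w.IsPath)
    (hfw : s(f.1, f.2) ∈ w.edges) : ¬ (graphOf (F.erase f)).Reachable u v := by
  intro hr
  obtain ⟨q, hq⟩ := hr.exists_isPath
  have hle := graphOf_mono (F.erase_subset f)
  have hwq : w = q.mapLe hle :=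
    congrArg Subtype.val ((hF.2.subsingleton_path u v).elim ⟨w, hw⟩ ⟨q.mapLe hle, hq.mapLe hle⟩)
  rw [hwq, SimpleGraph.Walk.edges_mapLe_eq_edges] at hfw
  rcases (graphOf_adj.1 (q.edges_subset_edgeSet hfw)).2 with h | h
  · exact Finset.notMem_erase f F h
  · exact (hF.1 f hf).asymm (hF.1 _ (Finset.mem_of_mem_erase h))

theorem IsForest.exists_exchange {E F : Finset (Fin p × Fin p)} {e : Fin p × Fin p}
    (hF : IsForest F) (hEe : IsForest (insert e E)) (hEF : E ⊆ F) (heF : e ∉ F)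
    (hFe : ¬ IsForest (insert e F)) :
    ∃ f ∈ F, f ∉ E ∧ IsForest (insert e (F.erase f)) := by
  have hlt := hEe.1 e (Finset.mem_insert_self e E)
  have hr : (graphOf F).Reachable e.1 e.2 :=
    not_not.1 fun hr => hFe (hF.insert_of_not_reachable hlt hr)
  obtain ⟨w, hw⟩ := hr.exists_isPath
  obtain ⟨s, hs, hsE⟩ : ∃ s ∈ w.edges, s ∉ (graphOf E).edgeSet := by
    by_contra! hall
    exact hEe.not_reachable_of_insert (fun h => heF (hEF h)) ⟨w.transfer _ hall⟩
  obtain ⟨f, hf, rfl⟩ := exists_mem_of_mem_edgeSet_graphOf (w.edges_subset_edgeSet hs)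
  refine ⟨f, hf, fun hfE => hsE (graphOf_adj.2 ⟨(hF.1 f hf).ne, Or.inl hfE⟩), ?_⟩
  exact (hF.subset (F.erase_subset f)).insert_of_not_reachable hlt
    (hF.not_reachable_erase hf hw hs)

theorem isForest_kruskalStep {w : Fin p → Fin p → ℝ} {E : Finset (Fin p × Fin p)}
    {e : Fin p × Fin p} (hE : IsForest E) (he : e.1 < e.2) : IsForest (kruskalStep w E e) := by
  rw [kruskalStep]
  split_ifs with h
  · exact ⟨Finset.forall_mem_insert _ _ _ |>.2 ⟨he, hE.1⟩, h.2⟩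
  · exact hE

theorem IsChowLiu.isForest {w : Fin p → Fin p → ℝ} {E : Finset (Fin p × Fin p)}
    (h : IsChowLiu w E) : IsForest E := by
  obtain ⟨l, -, hl, -, rfl⟩ := h
  exact List.foldlRecOn l _ IsForest.empty fun _ hF e he => isForest_kruskalStep hF ((hl e).1 he)

theorem IsForest.exists_le_weight_insert {w : Fin p → Fin p → ℝ} {E F : Finset (Fin p × Fin p)}
    {e : Fin p × Fin p} (hF : IsForest F) (hEF : E ⊆ F) (hEe : IsForest (insert e E))
    (hpos : 0 ≤ w e.1 e.2) (hmax : ∀ f ∈ F, f ∉ E → w f.1 f.2 ≤ w e.1 e.2) :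
    ∃ F', IsForest F' ∧ insert e E ⊆ F' ∧ F' ⊆ insert e F ∧
      ∑ f ∈ F, w f.1 f.2 ≤ ∑ f ∈ F', w f.1 f.2 := by
  by_cases heF : e ∈ F
  · exact ⟨F, hF, Finset.insert_subset heF hEF, Finset.subset_insert e F, le_rfl⟩
  by_cases hFe : IsForest (insert e F)
  · refine ⟨insert e F, hFe, Finset.insert_subset_insert e hEF, subset_rfl, ?_⟩
    rw [Finset.sum_insert heF]
    exact le_add_of_nonneg_left hpos
  · obtain ⟨f, hf, hfE, hFf⟩ := hF.exists_exchange hEe hEF heF hFe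
    refine ⟨insert e (F.erase f), hFf,
      Finset.insert_subset_insert e (Finset.subset_erase.2 ⟨hEF, hfE⟩),
      Finset.insert_subset_insert e (Finset.erase_subset f F), ?_⟩
    rw [Finset.sum_insert (mt Finset.mem_of_mem_erase heF), ← Finset.add_sum_erase F _ hf]
    gcongr
    exact hmax f hf hfE

theorem IsForest.exists_le_weight_kruskalStep {w : Fin p → Fin p → ℝ}
    {E F : Finset (Fin p × Fin p)} {e : Fin p × Fin p} (hF : IsForest F) (hEF : E ⊆ F)
    (he : e.1 < e.2) (hmax : ∀ f ∈ F, f ∉ E → w f.1 f.2 ≤ w e.1 e.2) :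
    ∃ F', IsForest F' ∧ kruskalStep w E e ⊆ F' ∧
      (∀ f ∈ F', f ∈ kruskalStep w E e ∨ f ∈ F ∧ f ≠ e) ∧
      ∑ f ∈ F, w f.1 f.2 ≤ ∑ f ∈ F', w f.1 f.2 := by
  rw [kruskalStep]
  split_ifs with h
  · have hEe : IsForest (insert e E) :=
      ⟨(Finset.forall_mem_insert _ _ _).2 ⟨he, (hF.subset hEF).1⟩, h.2⟩
    obtain ⟨F', hF', hE', hsub, hle⟩ := hF.exists_le_weight_insert hEF hEe h.1.le hmax
    refine ⟨F', hF', hE', fun f hf => ?_, hle⟩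
    have := hsub hf
    grind
  by_cases heE : e ∈ E
  · exact ⟨F, hF, hEF, fun f hf => by grind, le_rfl⟩
  refine ⟨F.erase e, hF.subset (F.erase_subset e), Finset.subset_erase.2 ⟨hEF, heE⟩,
    fun f hf => by grind, ?_⟩
  by_cases heF : e ∈ F
  · have hw : w e.1 e.2 ≤ 0 :=
      not_lt.1 fun hw => h ⟨hw, (hF.subset (Finset.insert_subset heF hEF)).2⟩
    rw [← Finset.add_sum_erase F _ heF]
    exact add_le_of_nonpos_left hw
  · rw [Finset.erase_eq_of_notMem heF]

theorem IsForest.weight_le_foldl_kruskalStep {w : Fin p → Fin p → ℝ} {l : List (Fin p × Fin p)}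
    (hl : ∀ e ∈ l, e.1 < e.2) (hs : l.Pairwise fun e f => w f.1 f.2 ≤ w e.1 e.2)
    {E F : Finset (Fin p × Fin p)} (hF : IsForest F) (hEF : E ⊆ F)
    (hFl : ∀ f ∈ F, f ∈ E ∨ f ∈ l) :
    ∑ e ∈ F, w e.1 e.2 ≤ ∑ e ∈ l.foldl (kruskalStep w) E, w e.1 e.2 := by
  induction l generalizing E F with
  | nil =>
    have hFE : F ⊆ E := fun f hf => by simpa using hFl f hf
    rw [List.foldl_nil, hFE.antisymm hEF]
  | cons e l ih =>
    rw [List.forall_mem_cons] at hl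
    rw [List.pairwise_cons] at hs
    have hmax : ∀ f ∈ F, f ∉ E → w f.1 f.2 ≤ w e.1 e.2 := fun f hf hfE =>
      (List.mem_cons.1 ((hFl f hf).resolve_left hfE)).elim (fun h => h ▸ le_rfl) (hs.1 f)
    obtain ⟨F', hF', hE', hsub, hle⟩ := hF.exists_le_weight_kruskalStep hEF hl.1 hmax
    refine hle.trans (ih hl.2 hs.2 hF' hE' fun f hf => ?_)
    have hE : E ⊆ kruskalStep w E e := by grind [kruskalStep]
    grind

theorem IsChowLiu.weight_le {w : Fin p → Fin p → ℝ} {E F : Finset (Fin p × Fin p)}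
    (h : IsChowLiu w E) (hF : IsForest F) :
    ∑ e ∈ F, w e.1 e.2 ≤ ∑ e ∈ E, w e.1 e.2 := by
  obtain ⟨l, -, hl, hs, rfl⟩ := h
  exact hF.weight_le_foldl_kruskalStep (fun e => (hl e).1) hs (Finset.empty_subset F)
    fun f hf => Or.inr ((hl f).2 (hF.1 f hf))

end Kruskal

section ProductWeight

variable {ι R : Type*} [Fintype ι] [DecidableEq ι] [CommSemiring R] {S : ι → Type*}
  [∀ i, Fintype (S i)] {m : ∀ i, S i → R}

theorem sum_prod_weight_eq_one (hm : ∀ i, ∑ a, m i a = 1) :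
    ∑ x : ∀ i, S i, ∏ i, m i (x i) = 1 := by
  rw [← Fintype.prod_sum]
  exact Finset.prod_eq_one fun i _ => hm i

theorem sum_prod_weight_mul_apply (hm : ∀ i, ∑ a, m i a = 1) (u : ι) (φ : S u → R) :
    ∑ x : ∀ i, S i, (∏ i, m i (x i)) * φ (x u) = ∑ a, m u a * φ a := by
  have hprod (x : ∀ i, S i) : (∏ i, m i (x i)) * φ (x u) =
      ∏ i, Function.update m u (fun a => m u a * φ a) i (x i) := by
    rw [Fintype.prod_eq_mul_prod_compl u, Fintype.prod_eq_mul_prod_compl u, Function.update_self,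
      mul_right_comm]
    congr 1
    refine Finset.prod_congr rfl fun i hi => ?_
    rw [Function.update_of_ne (by simpa using hi)]
  simp_rw [hprod]
  rw [← Fintype.prod_sum, Fintype.prod_eq_single u, Function.update_self]
  intro i hi
  rw [Function.update_of_ne hi, hm]

/-- Swapping the coordinates outside `A` of two independent samples preserves their law. -/
theorem sum_prod_weight_decouple (hm : ∀ i, ∑ a, m i a = 1) (A : Finset ι)
    {K : (∀ i, S i) → (∀ i, S i) → R}
    (hK : ∀ x x', K (A.piecewise x x') (A.piecewise x x') = K x x') :
    ∑ x, (∏ i, m i (x i)) * K x x =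
      ∑ x, (∏ i, m i (x i)) * ∑ x', (∏ i, m i (x' i)) * K x x' := by
  let σ : (∀ i, S i) × (∀ i, S i) → (∀ i, S i) × (∀ i, S i) :=
    fun q => (A.piecewise q.1 q.2, A.piecewise q.2 q.1)
  have hσ : Function.Involutive σ := by
    rintro ⟨x, x'⟩
    ext i <;> by_cases hi : i ∈ A <;> simp [σ, hi]
  have hprod (x x' : ∀ i, S i) :
      (∏ i, m i (A.piecewise x x' i)) * ∏ i, m i (A.piecewise x' x i) =
        (∏ i, m i (x i)) * ∏ i, m i (x' i) := by
    rw [← Finset.prod_mul_distrib, ← Finset.prod_mul_distrib]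
    refine Finset.prod_congr rfl fun i _ => ?_
    by_cases hi : i ∈ A <;> simp [hi, mul_comm]
  calc ∑ x, (∏ i, m i (x i)) * K x x
      = ∑ q : (∀ i, S i) × (∀ i, S i),
          (∏ i, m i (q.1 i)) * (∏ i, m i (q.2 i)) * K q.1 q.1 := by
        rw [Fintype.sum_prod_type]
        refine Finset.sum_congr rfl fun x _ => ?_
        simp only
        rw [← Finset.sum_mul, ← Finset.mul_sum, sum_prod_weight_eq_one hm, mul_one]
    _ = ∑ q : (∀ i, S i) × (∀ i, S i),
          (∏ i, m i (q.1 i)) * (∏ i, m i (q.2 i)) * K q.1 q.2 := by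
        rw [← Equiv.sum_comp hσ.toPerm]
        refine Finset.sum_congr rfl fun q _ => ?_
        simp only [Function.Involutive.coe_toPerm, σ, hprod, hK]
    _ = ∑ x, (∏ i, m i (x i)) * ∑ x', (∏ i, m i (x' i)) * K x x' := by
        simp_rw [Fintype.sum_prod_type, mul_assoc, ← Finset.mul_sum]

end ProductWeight

section ForestWeight

variable {p : ℕ} {R : Type*} [CommSemiring R] {S : Fin p → Type*}

/-- The product of the vertex weights `m` and of the weights `g` of the edges in `D`: the density
of a Markov field on the forest `D`. -/
def forestWeight (m : ∀ i, S i → R) (g : ∀ e : Fin p × Fin p, S e.1 → S e.2 → R)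
    (D : Finset (Fin p × Fin p)) (x : ∀ i, S i) : R :=
  (∏ i, m i (x i)) * ∏ e ∈ D, g e (x e.1) (x e.2)

variable {m : ∀ i, S i → R} {g : ∀ e : Fin p × Fin p, S e.1 → S e.2 → R}
  {D : Finset (Fin p × Fin p)} {e : Fin p × Fin p}

theorem forestWeight_eq_zero {x : ∀ i, S i} {i : Fin p} (h : m i (x i) = 0) :
    forestWeight m g D x = 0 := by
  rw [forestWeight, Finset.prod_eq_zero (Finset.mem_univ i) h, zero_mul]

theorem forestWeight_eq_erase_mul (he : e ∈ D) (x : ∀ i, S i) :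
    forestWeight m g D x = forestWeight m g (D.erase e) x * g e (x e.1) (x e.2) := by
  rw [forestWeight, forestWeight, mul_assoc, Finset.prod_erase_mul _ _ he]

theorem forestWeight_mul_eq {x : ∀ i, S i} {i : Fin p} {c d : R}
    (h : m i (x i) ≠ 0 → c = 1) :
    forestWeight m g D x * (c * d) = forestWeight m g D x * d := by
  by_cases h0 : m i (x i) = 0
  · rw [forestWeight_eq_zero h0, zero_mul, zero_mul]
  · rw [h h0, one_mul]

theorem IsForest.exists_component (hD : IsForest D) (he : e ∈ D) :
    ∃ A : Finset (Fin p), e.1 ∈ A ∧ e.2 ∉ A ∧ ∀ f ∈ D.erase e, (f.1 ∈ A ↔ f.2 ∈ A) := by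
  classical
  refine ⟨Finset.univ.filter ((graphOf (D.erase e)).Reachable e.1), by simp, ?_, fun f hf => ?_⟩
  · rw [← Finset.insert_erase he] at hD
    simpa using hD.not_reachable_of_insert (Finset.notMem_erase e D)
  · have hadj : (graphOf (D.erase e)).Adj f.1 f.2 :=
      graphOf_adj.2 ⟨(hD.1 f (Finset.mem_of_mem_erase hf)).ne, Or.inl hf⟩
    simpa using ⟨fun h => h.trans hadj.reachable, fun h => h.trans hadj.symm.reachable⟩

/-- The edge weights `g e` are densities, with respect to the product of the weights of the
endpoints, of couplings of these weights. -/
def IsCoupling (m : ∀ i, S i → R) (g : ∀ e : Fin p × Fin p, S e.1 → S e.2 → R)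
    [∀ i, Fintype (S i)] (D : Finset (Fin p × Fin p)) : Prop :=
  ∀ e ∈ D, (∀ a, m e.1 a ≠ 0 → ∑ b, m e.2 b * g e a b = 1) ∧
    ∀ b, m e.2 b ≠ 0 → ∑ a, m e.1 a * g e a b = 1

variable [∀ i, Fintype (S i)]

theorem sum_forestWeight_decouple (hm : ∀ i, ∑ a, m i a = 1) {A : Finset (Fin p)}
    (hA : ∀ f ∈ D, (f.1 ∈ A ↔ f.2 ∈ A)) {K : (∀ i, S i) → (∀ i, S i) → R}
    (hK : ∀ x x', K (A.piecewise x x') (A.piecewise x x') = K x x') :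
    ∑ x, forestWeight m g D x * K x x =
      ∑ x, forestWeight m g {f ∈ D | f.1 ∈ A} x *
        ∑ x', forestWeight m g {f ∈ D | f.1 ∉ A} x' * K x x' := by
  let G (D : Finset (Fin p × Fin p)) (x : ∀ i, S i) : R := ∏ f ∈ D, g f (x f.1) (x f.2)
  calc ∑ x, forestWeight m g D x * K x x
      = ∑ x, (∏ i, m i (x i)) * (G {f ∈ D | f.1 ∈ A} x * (G {f ∈ D | f.1 ∉ A} x * K x x)) := by
        simp_rw [G, forestWeight, ← mul_assoc _ _ (K _ _), mul_assoc (∏ _, _),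
          Finset.prod_filter_mul_prod_filter_not]
    _ = _ := by
        refine sum_prod_weight_decouple hm A (K := fun x x' =>
          G {f ∈ D | f.1 ∈ A} x * (G {f ∈ D | f.1 ∉ A} x' * K x x')) fun x x' => ?_
        simp only [G, hK]
        congr 1
        · refine Finset.prod_congr rfl fun f hf => ?_
          obtain ⟨hfD, hfA⟩ := Finset.mem_filter.1 hf
          simp [hfA, (hA f hfD).1 hfA]
        · congr 1
          refine Finset.prod_congr rfl fun f hf => ?_
          obtain ⟨hfD, hfA⟩ := Finset.mem_filter.1 hf
          simp [hfA, mt (hA f hfD).2 hfA]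
    _ = _ := by
        simp only [forestWeight, G, Finset.mul_sum]
        exact Finset.sum_congr rfl fun x _ => Finset.sum_congr rfl fun x' _ => by ring

theorem IsCoupling.subset {D' : Finset (Fin p × Fin p)} (h : IsCoupling m g D) (hD : D' ⊆ D) :
    IsCoupling m g D' := fun e he => h e (hD he)

theorem sum_forestWeight_vertex (hm : ∀ i, ∑ a, m i a = 1) (hD : IsForest D)
    (hg : IsCoupling m g D) (u : Fin p) (φ : S u → R) :
    ∑ x, forestWeight m g D x * φ (x u) = ∑ a, m u a * φ a := by
  induction D using Finset.strongInduction generalizing u φ with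
  | H D ih =>
    rcases D.eq_empty_or_nonempty with rfl | ⟨e, he⟩
    · simpa [forestWeight] using sum_prod_weight_mul_apply hm u φ
    obtain ⟨A, he₁, he₂, hA⟩ := hD.exists_component he
    have hmarg (q : Fin p × Fin p → Prop) [DecidablePred q] (v : Fin p) (ψ : S v → R) :
        ∑ x, forestWeight m g {f ∈ D.erase e | q f} x * ψ (x v) = ∑ a, m v a * ψ a := by
      have hss : {f ∈ D.erase e | q f} ⊂ D :=
        (Finset.filter_subset q _).trans_ssubset (Finset.erase_ssubset he)
      exact ih _ hss (hD.subset hss.subset) (hg.subset hss.subset) v ψ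
    obtain ⟨hg₁, hg₂⟩ := hg e he
    simp_rw [forestWeight_eq_erase_mul he, mul_assoc]
    by_cases hu : u ∈ A
    · rw [sum_forestWeight_decouple hm hA (K := fun x x' => g e (x e.1) (x' e.2) * φ (x u))
        (by simp [he₁, he₂, hu]), ← hmarg (·.1 ∈ A) u φ]
      refine Finset.sum_congr rfl fun x _ => ?_
      simp_rw [← mul_assoc, ← Finset.sum_mul, hmarg (·.1 ∉ A) e.2 fun b => g e (x e.1) b]
      exact forestWeight_mul_eq (hg₁ _)
    · rw [sum_forestWeight_decouple hm hA (K := fun x x' => g e (x e.1) (x' e.2) * φ (x' u))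
        (by simp [he₁, he₂, hu]), ← hmarg (·.1 ∉ A) u φ]
      simp_rw [Finset.mul_sum]
      rw [Finset.sum_comm]
      refine Finset.sum_congr rfl fun x' _ => ?_
      rw [← forestWeight_mul_eq (hg₂ _), ← hmarg (·.1 ∈ A) e.1 fun a => g e a (x' e.2),
        Finset.sum_mul, Finset.mul_sum]
      exact Finset.sum_congr rfl fun x _ => by ring

theorem sum_forestWeight_edge (hm : ∀ i, ∑ a, m i a = 1) (hD : IsForest D)
    (hg : IsCoupling m g D) (he : e ∈ D) (φ : S e.1 → S e.2 → R) :
    ∑ x, forestWeight m g D x * φ (x e.1) (x e.2) =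
      ∑ a, ∑ b, m e.1 a * m e.2 b * g e a b * φ a b := by
  obtain ⟨A, he₁, he₂, hA⟩ := hD.exists_component he
  have hmarg (q : Fin p × Fin p → Prop) [DecidablePred q] (v : Fin p) (ψ : S v → R) :
      ∑ x, forestWeight m g {f ∈ D.erase e | q f} x * ψ (x v) = ∑ a, m v a * ψ a := by
    have hss : {f ∈ D.erase e | q f} ⊆ D :=
      (Finset.filter_subset q _).trans (D.erase_subset e)
    exact sum_forestWeight_vertex hm (hD.subset hss) (hg.subset hss) v ψ
  simp_rw [forestWeight_eq_erase_mul he, mul_assoc]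
  rw [sum_forestWeight_decouple hm hA
    (K := fun x x' => g e (x e.1) (x' e.2) * φ (x e.1) (x' e.2)) (by simp [he₁, he₂])]
  have hmarg₂ (a : S e.1) := hmarg (·.1 ∉ A) e.2 fun b => g e a b * φ a b
  simp_rw [hmarg₂, hmarg (·.1 ∈ A) e.1 fun a => ∑ b, m e.2 b * (g e a b * φ a b), Finset.mul_sum]

end ForestWeight

section Entropy

variable {p : ℕ} {S : Fin p → Type*} {m : ∀ i, S i → ℝ}
  {g : ∀ e : Fin p × Fin p, S e.1 → S e.2 → ℝ} {D : Finset (Fin p × Fin p)}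

theorem negMulLog_forestWeight (x : ∀ i, S i) :
    Real.negMulLog (forestWeight m g D x) =
      ∑ i, forestWeight m g D x * -Real.log (m i (x i)) -
        ∑ e ∈ D, forestWeight m g D x * Real.log (g e (x e.1) (x e.2)) := by
  rw [← Finset.mul_sum, ← Finset.mul_sum, ← mul_sub]
  by_cases h0 : forestWeight m g D x = 0
  · simp [h0]
  obtain ⟨hm0, hg0⟩ := mul_ne_zero_iff.1 h0
  have hlog : Real.log (forestWeight m g D x) =
      ∑ i, Real.log (m i (x i)) + ∑ e ∈ D, Real.log (g e (x e.1) (x e.2)) := by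
    rw [forestWeight, Real.log_mul hm0 hg0, Real.log_prod (Finset.prod_ne_zero_iff.1 hm0),
      Real.log_prod (Finset.prod_ne_zero_iff.1 hg0)]
  rw [Real.negMulLog, hlog, Finset.sum_neg_distrib]
  ring

theorem sum_negMulLog_forestWeight [∀ i, Fintype (S i)] (hm : ∀ i, ∑ a, m i a = 1)
    (hD : IsForest D) (hg : IsCoupling m g D) :
    ∑ x, Real.negMulLog (forestWeight m g D x) =
      ∑ i, ∑ a, Real.negMulLog (m i a) -
        ∑ e ∈ D, ∑ a, ∑ b, m e.1 a * m e.2 b * g e a b * Real.log (g e a b) := by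
  simp_rw [negMulLog_forestWeight]
  rw [Finset.sum_sub_distrib, Finset.sum_comm, Finset.sum_comm (t := D)]
  congr 1
  · refine Finset.sum_congr rfl fun i _ => ?_
    simp_rw [sum_forestWeight_vertex hm hD hg i fun a => -Real.log (m i a), mul_neg,
      Real.negMulLog, neg_mul]
  · exact Finset.sum_congr rfl fun e he =>
      sum_forestWeight_edge hm hD hg he fun a b => Real.log (g e a b)

theorem sum_mul_log_div_eq {A B : Type*} [Fintype A] [Fintype B] {f : A → B → ℝ} {u : A → ℝ}
    {v : B → ℝ} (hf : ∀ a b, 0 ≤ f a b) (hu : ∀ a, ∑ b, f a b = u a)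
    (hv : ∀ b, ∑ a, f a b = v b) :
    ∑ a, ∑ b, f a b * Real.log (f a b / (u a * v b)) =
      ∑ a, Real.negMulLog (u a) + ∑ b, Real.negMulLog (v b) -
        ∑ a, ∑ b, Real.negMulLog (f a b) := by
  have hlog (a : A) (b : B) : f a b * Real.log (f a b / (u a * v b)) =
      -(f a b * Real.log (u a)) + -(f a b * Real.log (v b)) - Real.negMulLog (f a b) := by
    rcases (hf a b).eq_or_lt with h | h
    · simp [← h]
    have hu0 : u a ≠ 0 := (h.trans_le (hu a ▸ Finset.single_le_sum (f := f a)
      (fun b _ => hf a b) (Finset.mem_univ b))).ne'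
    have hv0 : v b ≠ 0 := (h.trans_le (hv b ▸ Finset.single_le_sum (f := fun a => f a b)
      (fun a _ => hf a b) (Finset.mem_univ a))).ne'
    rw [Real.log_div h.ne' (mul_ne_zero hu0 hv0), Real.log_mul hu0 hv0, Real.negMulLog]
    ring
  simp_rw [hlog, Finset.sum_sub_distrib, Finset.sum_add_distrib]
  rw [Finset.sum_comm (f := fun a b => -(f a b * Real.log (v b)))]
  simp_rw [Finset.sum_neg_distrib, ← Finset.sum_mul, hu, hv, Real.negMulLog, neg_mul,
    Finset.sum_neg_distrib]

end Entropy

section BayesMeasure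

open Filter Topology

/-- The error of Stirling's approximation of `log Γ(n + s)`. -/
noncomputable def stirlingError (s : ℝ) (n : ℕ) : ℝ :=
  Real.log (Real.Gamma (n + s)) - (n * Real.log n - n + (s - 1 / 2) * Real.log n)

theorem stirlingError_eq {s : ℝ} (hs : 0 < s) {n : ℕ} (hn : n ≠ 0) :
    stirlingError s n =
      Real.log (Real.Gamma s) - Real.BohrMollerup.logGammaSeq s n +
        Real.log (Stirling.stirlingSeq n) + Real.log 2 / 2 + Real.log (n / (n + s)) := by
  have hn0 : (n : ℝ) ≠ 0 := Nat.cast_ne_zero.2 hn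
  have hGamma : Real.log (Real.Gamma (n + s)) =
      Real.log (Real.Gamma s) + ∑ m ∈ Finset.range n, Real.log (s + m) := by
    rw [add_comm]
    refine Real.BohrMollerup.f_add_nat_eq (f := Real.log ∘ Real.Gamma) (fun {y} hy => ?_) hs n
    rw [Function.comp, Function.comp, Real.Gamma_add_one hy.ne',
      Real.log_mul hy.ne' (Real.Gamma_pos_of_pos hy).ne', add_comm]
  rw [stirlingError, hGamma, Real.BohrMollerup.logGammaSeq, Finset.sum_range_succ,
    Stirling.log_stirlingSeq_formula, Real.log_mul two_ne_zero hn0,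
    Real.log_div (x := n) hn0 (Real.exp_ne_zero 1), Real.log_exp,
    Real.log_div (x := n) hn0 (by positivity), add_comm s n]
  ring

theorem tendsto_stirlingError {s : ℝ} (hs : 0 < s) :
    Tendsto (stirlingError s) atTop (𝓝 (Real.log √Real.pi + Real.log 2 / 2)) := by
  have hGamma : Tendsto (Real.BohrMollerup.logGammaSeq s) atTop (𝓝 (Real.log (Real.Gamma s))) :=
    Real.BohrMollerup.tendsto_log_gamma hs
  have hStirling : Tendsto (fun n => Real.log (Stirling.stirlingSeq n)) atTop
      (𝓝 (Real.log √Real.pi)) :=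
    Stirling.tendsto_stirlingSeq_sqrt_pi.log (by positivity)
  have hratio : Tendsto (fun n : ℕ => Real.log (n / (n + s))) atTop (𝓝 (Real.log 1)) :=
    (tendsto_natCast_div_add_atTop s).log one_ne_zero
  have hsum := (((hGamma.const_sub (Real.log (Real.Gamma s))).add hStirling).add_const
    (Real.log 2 / 2)).add hratio
  rw [sub_self, zero_add, Real.log_one, add_zero] at hsum
  refine hsum.congr' ?_
  filter_upwards [eventually_ne_atTop 0] with n hn using (stirlingError_eq hs hn).symm

theorem exists_abs_stirlingError_le {s : ℝ} (hs : 0 < s) : ∃ K, ∀ n, |stirlingError s n| ≤ K := by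
  obtain ⟨K, hK⟩ := (tendsto_stirlingError hs).abs.bddAbove_range
  exact ⟨K, fun n => hK ⟨n, rfl⟩⟩

/-- `n log n - ∑ c log c`, where `n = ∑ c`: if the symbols occur `c a` times in a sequence, the
length of its ideal code based on its empirical distribution. -/
noncomputable def empiricalLength {A : Type*} [Fintype A] (c : A → ℝ) : ℝ :=
  ∑ a, Real.negMulLog (c a) - Real.negMulLog (∑ a, c a)

variable {A : Type*} [Fintype A] [Nonempty A]

theorem bayesMeasure_pos (c : A → ℕ) : 0 < bayesMeasure c := by
  have hsum : 0 < ∑ a, ((c a : ℝ) + 1 / 2) :=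
    Finset.sum_pos (fun a _ => by positivity) Finset.univ_nonempty
  rw [bayesMeasure]
  have hG := @Real.Gamma_pos_of_pos
  exact mul_pos (div_pos (hG (by positivity)) (hG hsum))
    (Finset.prod_pos fun a _ => div_pos (hG (by positivity)) (hG (by norm_num)))

theorem log_bayesMeasure (c : A → ℕ) :
    Real.log (bayesMeasure c) = Real.log (Real.Gamma (Fintype.card A / 2)) -
      Real.log (Real.Gamma ((∑ a, c a : ℕ) + Fintype.card A / 2)) +
      ∑ a, (Real.log (Real.Gamma (c a + 1 / 2)) - Real.log (Real.Gamma (1 / 2))) := by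
  have hG {s : ℝ} (hs : 0 < s) : Real.Gamma s ≠ 0 := (Real.Gamma_pos_of_pos hs).ne'
  have hc (a : A) : Real.Gamma (c a + 1 / 2) ≠ 0 := hG (by positivity)
  have hhalf : Real.Gamma (1 / 2) ≠ 0 := hG (by norm_num)
  have hsum : ∑ a, ((c a : ℝ) + 1 / 2) = (∑ a, c a : ℕ) + (Fintype.card A : ℝ) / 2 := by
    rw [Finset.sum_add_distrib, Finset.sum_const, Finset.card_univ, nsmul_eq_mul, Nat.cast_sum]
    ring
  have hratio (a : A) : Real.Gamma (c a + 1 / 2) / Real.Gamma (1 / 2) ≠ 0 :=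
    div_ne_zero (hc a) hhalf
  rw [bayesMeasure, hsum,
    Real.log_mul (div_ne_zero (hG (by positivity)) (hG (by positivity)))
      (Finset.prod_ne_zero_iff.2 fun a _ => hratio a),
    Real.log_div (hG (by positivity)) (hG (by positivity)), Real.log_prod fun a _ => hratio a]
  simp_rw [Real.log_div (hc _) hhalf]

theorem log_bayesMeasure_add_empiricalLength (c : A → ℕ) :
    Real.log (bayesMeasure c) + empiricalLength (fun a => (c a : ℝ)) +
        ((Fintype.card A : ℝ) - 1) / 2 * Real.log (∑ a, c a : ℕ) =
      Real.log (Real.Gamma (Fintype.card A / 2)) - stirlingError (Fintype.card A / 2) (∑ a, c a) +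
        ∑ a, (stirlingError (1 / 2) (c a) - Real.log (Real.Gamma (1 / 2))) := by
  simp_rw [log_bayesMeasure, empiricalLength, Real.negMulLog, stirlingError, sub_self, zero_mul,
    add_zero, Finset.sum_sub_distrib, neg_mul, Finset.sum_neg_distrib]
  push_cast
  ring

variable (A) in
theorem exists_abs_log_bayesMeasure_le :
    ∃ K : ℝ, ∀ c : A → ℕ,
      |Real.log (bayesMeasure c) + empiricalLength (fun a => (c a : ℝ)) +
        ((Fintype.card A : ℝ) - 1) / 2 * Real.log (∑ a, c a : ℕ)| ≤ K := by
  have hcard : (0 : ℝ) < Fintype.card A := by exact_mod_cast Fintype.card_pos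
  obtain ⟨K, hK⟩ := exists_abs_stirlingError_le (half_pos hcard)
  obtain ⟨K', hK'⟩ := exists_abs_stirlingError_le one_half_pos
  refine ⟨|Real.log (Real.Gamma (Fintype.card A / 2))| + K +
    ∑ _a : A, (K' + |Real.log (Real.Gamma (1 / 2))|), fun c => ?_⟩
  rw [log_bayesMeasure_add_empiricalLength]
  refine (abs_add_le _ _).trans (add_le_add ((abs_sub _ _).trans ?_)
    ((Finset.abs_sum_le_sum_abs _ _).trans (Finset.sum_le_sum fun a _ => (abs_sub _ _).trans ?_)))
  · gcongr
    exact hK _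
  · gcongr
    exact hK' _

end BayesMeasure

section BoundedVariance

variable {Ω : Type*} [MeasurableSpace Ω] {μ : Measure Ω} [IsProbabilityMeasure μ] {N : Ω → ℝ}
  {c : ℝ}

theorem sub_le_negMulLog {x m : ℝ} (hx : 0 ≤ x) (hm : 0 < m) :
    x - x ^ 2 / m - x * Real.log m ≤ Real.negMulLog x := by
  rcases hx.eq_or_lt with rfl | hx
  · simp
  have hlog := Real.log_le_sub_one_of_pos (div_pos hx hm)
  rw [Real.log_div hx.ne' hm.ne'] at hlog
  calc x - x ^ 2 / m - x * Real.log m = x * -(x / m - 1 + Real.log m) := by ring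
    _ ≤ x * -Real.log x := by gcongr; linarith
    _ = Real.negMulLog x := by rw [Real.negMulLog]; ring

theorem integrable_negMulLog (hN : AEStronglyMeasurable N μ) (hc : ∀ ω, N ω ∈ Set.Icc 0 c) :
    Integrable (fun ω => Real.negMulLog (N ω)) μ := by
  obtain ⟨K, hK⟩ := isCompact_Icc.exists_bound_of_continuousOn
    Real.continuous_negMulLog.continuousOn
  exact .of_bound (Real.continuous_negMulLog.comp_aestronglyMeasurable hN) K
    (.of_forall fun ω => hK _ (hc ω))

theorem memLp_two_of_mem_Icc (hN : AEStronglyMeasurable N μ) (hc : ∀ ω, N ω ∈ Set.Icc 0 c) :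
    MemLp N 2 μ :=
  .of_bound hN c (.of_forall fun ω => by
    rw [Real.norm_of_nonneg (hc ω).1]
    exact (hc ω).2)

theorem integral_negMulLog_le (hN : AEStronglyMeasurable N μ) (hc : ∀ ω, N ω ∈ Set.Icc 0 c) :
    ∫ ω, Real.negMulLog (N ω) ∂μ ≤ Real.negMulLog (∫ ω, N ω ∂μ) :=
  Real.concaveOn_negMulLog.le_map_integral Real.continuous_negMulLog.continuousOn isClosed_Ici
    (.of_forall fun ω => (hc ω).1) ((memLp_two_of_mem_Icc hN hc).integrable one_le_two)
    (integrable_negMulLog hN hc)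

theorem le_integral_negMulLog_of_variance_le (hN : AEStronglyMeasurable N μ)
    (hc : ∀ ω, N ω ∈ Set.Icc 0 c) (hvar : Var[N; μ] ≤ ∫ ω, N ω ∂μ) :
    Real.negMulLog (∫ ω, N ω ∂μ) - 1 ≤ ∫ ω, Real.negMulLog (N ω) ∂μ := by
  have hL2 := memLp_two_of_mem_Icc hN hc
  have hint := hL2.integrable one_le_two
  have hpos : 0 ≤ N := fun ω => (hc ω).1
  rcases (integral_nonneg hpos).eq_or_lt with hm | hm
  · have hN0 := (integral_eq_zero_iff_of_nonneg hpos hint).1 hm.symm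
    have hη : ∫ ω, Real.negMulLog (N ω) ∂μ = 0 :=
      integral_eq_zero_of_ae (hN0.mono fun ω hω => by simp [hω])
    simp [← hm, hη]
  set m := ∫ ω, N ω ∂μ
  have hsq : ∫ ω, N ω ^ 2 ∂μ ≤ m + m ^ 2 := by
    rw [variance_eq_sub hL2] at hvar
    simpa using hvar
  have hsub : Integrable (fun ω => N ω - N ω ^ 2 / m) μ :=
    hint.sub (hL2.integrable_sq.div_const m)
  calc Real.negMulLog m - 1 = m - (m + m ^ 2) / m - m * Real.log m := by
        rw [Real.negMulLog]
        field_simp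
        ring
    _ ≤ m - (∫ ω, N ω ^ 2 ∂μ) / m - m * Real.log m := by gcongr
    _ = ∫ ω, (N ω - N ω ^ 2 / m - N ω * Real.log m) ∂μ := by
        rw [integral_sub hsub (hint.mul_const _),
          integral_sub hint (hL2.integrable_sq.div_const m), integral_div, integral_mul_const]
    _ ≤ ∫ ω, Real.negMulLog (N ω) ∂μ :=
        integral_mono (hsub.sub (hint.mul_const _))
          (integrable_negMulLog hN hc) fun ω => sub_le_negMulLog (hpos ω) hm

variable {ι : Type*} [Fintype ι] {Z : ι → Ω → ℝ}

theorem variance_sum_le_integral (hZ : ∀ k, AEStronglyMeasurable (Z k) μ)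
    (h01 : ∀ k ω, Z k ω ∈ Set.Icc 0 1) (hind : iIndepFun Z μ) :
    Var[fun ω => ∑ k, Z k ω; μ] ≤ ∫ ω, ∑ k, Z k ω ∂μ := by
  have hL2 (k : ι) : MemLp (Z k) 2 μ := memLp_two_of_mem_Icc (hZ k) (h01 k)
  have hsum : (fun ω => ∑ k, Z k ω) = ∑ k, Z k := by ext ω; simp
  rw [hsum, IndepFun.variance_sum (fun k _ => hL2 k) fun _ _ _ _ hkl => hind.indepFun hkl,
    ← hsum, integral_finsetSum _ fun k _ => (hL2 k).integrable one_le_two]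
  refine Finset.sum_le_sum fun k _ => (variance_le_expectation_sq (hZ k)).trans ?_
  exact integral_mono (hL2 k).integrable_sq ((hL2 k).integrable one_le_two) fun ω =>
    pow_le_of_le_one (h01 k ω).1 (h01 k ω).2 two_ne_zero

theorem integral_negMulLog_sum_mem_Icc (hZ : ∀ k, AEStronglyMeasurable (Z k) μ)
    (h01 : ∀ k ω, Z k ω ∈ Set.Icc 0 1) (hind : iIndepFun Z μ) :
    ∫ ω, Real.negMulLog (∑ k, Z k ω) ∂μ ∈
      Set.Icc (Real.negMulLog (∑ k, ∫ ω, Z k ω ∂μ) - 1)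
        (Real.negMulLog (∑ k, ∫ ω, Z k ω ∂μ)) := by
  have hN : AEStronglyMeasurable (fun ω => ∑ k, Z k ω) μ :=
    Finset.aestronglyMeasurable_fun_sum _ fun k _ => hZ k
  have hc (ω : Ω) : ∑ k, Z k ω ∈ Set.Icc 0 (∑ _k : ι, (1 : ℝ)) :=
    ⟨Finset.sum_nonneg fun k _ => (h01 k ω).1, Finset.sum_le_sum fun k _ => (h01 k ω).2⟩
  rw [← integral_finsetSum _ fun k _ =>
    (memLp_two_of_mem_Icc (hZ k) (h01 k)).integrable one_le_two]
  exact ⟨le_integral_negMulLog_of_variance_le hN hc (variance_sum_le_integral hZ h01 hind),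
    integral_negMulLog_le hN hc⟩

end BoundedVariance

section HitCount

variable {S A : Type*} [Fintype A] {n : ℕ}

open Classical in
/-- The number of terms of the sequence `x` that lie in `B`. -/
noncomputable def hitCount (x : Fin n → S) (B : Set S) : ℕ :=
  (Finset.univ.filter fun k => x k ∈ B).card

theorem hitCount_eq_sum_indicator (x : Fin n → S) (B : Set S) :
    (hitCount x B : ℝ) = ∑ k, B.indicator 1 (x k) := by
  classical
  simp [hitCount, Set.indicator_apply]

theorem sum_hitCount (x : Fin n → S) {B : A → Set S} (hB : Pairwise (Function.onFun Disjoint B)) :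
    ∑ a, hitCount x (B a) = hitCount x (⋃ a, B a) := by
  classical
  have hcover : (Finset.univ.filter fun k => x k ∈ ⋃ a, B a) =
      Finset.univ.biUnion fun a => Finset.univ.filter fun k => x k ∈ B a := by
    ext k
    simp
  simp_rw [hitCount, hcover]
  refine (Finset.card_biUnion fun a _ b _ hab => ?_).symm
  exact Finset.disjoint_filter.2 fun k _ ha hb => Set.disjoint_left.1 (hB hab) ha hb

theorem empiricalLength_const_mul {m : A → ℝ} (hm : ∑ a, m a = 1) (c : ℝ) :
    empiricalLength (fun a => c * m a) = c * ∑ a, Real.negMulLog (m a) := by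
  simp_rw [empiricalLength, ← Finset.mul_sum, Real.negMulLog_mul, Finset.sum_add_distrib,
    ← Finset.mul_sum, ← Finset.sum_mul, hm]
  simp

variable [Finite S] [MeasurableSpace S] [MeasurableSingletonClass S]
  (κ : Fin n → Measure S) [∀ k, IsProbabilityMeasure (κ k)]

theorem integral_negMulLog_hitCount_mem_Icc (B : Set S) :
    ∫ x, Real.negMulLog (hitCount x B) ∂Measure.pi κ ∈
      Set.Icc (Real.negMulLog (∑ k, (κ k).real B) - 1) (Real.negMulLog (∑ k, (κ k).real B)) := by
  have hint (k : Fin n) : ∫ x, B.indicator 1 (x k) ∂Measure.pi κ = (κ k).real B := by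
    rw [integral_comp_eval (μ := κ) (i := k) (f := B.indicator (1 : S → ℝ))
      (measurable_of_finite _).aestronglyMeasurable,
      integral_indicator_one (Set.toFinite B).measurableSet]
  simp_rw [hitCount_eq_sum_indicator, ← hint]
  refine integral_negMulLog_sum_mem_Icc (fun k => (measurable_of_finite _).aestronglyMeasurable)
    (fun k x => ?_) (iIndepFun_pi fun k => (measurable_of_finite _).aemeasurable)
  by_cases hx : x k ∈ B <;> simp [hx]

theorem integral_empiricalLength_hitCount_mem_Icc {B : A → Set S}
    (hB : Pairwise (Function.onFun Disjoint B)) :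
    ∫ x, empiricalLength (fun a => (hitCount x (B a) : ℝ)) ∂Measure.pi κ ∈
      Set.Icc (empiricalLength (fun a => ∑ k, (κ k).real (B a)) - Fintype.card A)
        (empiricalLength (fun a => ∑ k, (κ k).real (B a)) + 1) := by
  have hsum : ∑ a, ∑ k, (κ k).real (B a) = ∑ k, (κ k).real (⋃ a, B a) := by
    rw [Finset.sum_comm]
    refine Finset.sum_congr rfl fun k _ => ?_
    rw [measureReal_iUnion_fintype hB fun a => (Set.toFinite _).measurableSet]
  have hcell (a : A) := integral_negMulLog_hitCount_mem_Icc κ (B a)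
  have hunion := integral_negMulLog_hitCount_mem_Icc κ (⋃ a, B a)
  have hlower := Finset.sum_le_sum fun a (_ : a ∈ Finset.univ) => (hcell a).1
  have hupper := Finset.sum_le_sum fun a (_ : a ∈ Finset.univ) => (hcell a).2
  simp only [Finset.sum_sub_distrib, Finset.sum_const, Finset.card_univ, nsmul_one] at hlower
  simp_rw [empiricalLength, ← Nat.cast_sum, sum_hitCount _ hB]
  rw [integral_sub .of_finite .of_finite, integral_finsetSum _ fun a _ => .of_finite, hsum]
  constructor <;> linarith [hunion.1, hunion.2]

theorem integral_empiricalLength_hitCount_mem_Icc_of_indicator {T : Type*} {y : Fin n → T}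
    {B : A → Set S} (hB : Pairwise (Function.onFun Disjoint B)) {O : Set T} {m : A → ℝ}
    (hm : ∀ k, y k ∈ O → ∑ a, m a = 1)
    (hmem : ∀ k a, (κ k).real (B a) = O.indicator (fun _ => m a) (y k)) :
    ∫ x, empiricalLength (fun a => (hitCount x (B a) : ℝ)) ∂Measure.pi κ ∈
      Set.Icc (hitCount y O * ∑ a, Real.negMulLog (m a) - Fintype.card A)
        (hitCount y O * ∑ a, Real.negMulLog (m a) + 1) := by
  have hmean (a : A) : ∑ k, (κ k).real (B a) = hitCount y O * m a := by
    rw [hitCount_eq_sum_indicator, Finset.sum_mul]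
    refine Finset.sum_congr rfl fun k _ => ?_
    rw [hmem]
    by_cases hk : y k ∈ O <;> simp [hk]
  have hlen : empiricalLength (fun a => hitCount y O * m a) =
      hitCount y O * ∑ a, Real.negMulLog (m a) := by
    by_cases hO : ∃ k, y k ∈ O
    · obtain ⟨k, hk⟩ := hO
      exact empiricalLength_const_mul (hm k hk) _
    · push Not at hO
      simp [hitCount_eq_sum_indicator, hO, empiricalLength]
  simpa only [hmean, hlen] using integral_empiricalLength_hitCount_mem_Icc κ hB

end HitCount

section Channel

variable {S T Ω : Type*} [MeasurableSpace S] [MeasurableSpace T] [MeasurableSpace Ω]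

/-- The law of the output `X 0` of a channel given that its input `Y 0` is `t`. It is the zero
measure if `Y 0 = t` has probability `0`. -/
noncomputable def outputLaw (μ : Measure Ω) (X : ℕ → Ω → S) (Y : ℕ → Ω → T) (t : T) : Measure S :=
  (μ[|{ω | Y 0 ω = t}]).map (X 0)

instance (μ : Measure Ω) (X : ℕ → Ω → S) (Y : ℕ → Ω → T) (t : T) :
    IsFiniteMeasure (outputLaw μ X Y t) := by
  unfold outputLaw
  infer_instance

/-- `X` is the output of a memoryless channel with identically distributed inputs `Y`: given `Y`,
the `X k` are independent and `X k` has the law `outputLaw μ X Y (Y k)`. -/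
structure IsMemorylessChannel (μ : Measure Ω) (X : ℕ → Ω → S) (Y : ℕ → Ω → T) : Prop where
  measurable_X : ∀ k, Measurable (X k)
  measurable_Y : ∀ k, Measurable (Y k)
  identDistrib : ∀ k, IdentDistrib (Y k) (Y 0) μ μ
  memoryless : ∀ (n : ℕ) (x : Fin n → S) (y : Fin n → T),
    μ.real {ω | ∀ k : Fin n, X k ω = x k ∧ Y k ω = y k} =
      μ.real {ω | ∀ k : Fin n, Y k ω = y k} *
        ∏ k : Fin n, (μ[|{ω | Y 0 ω = y k}]).real {ω | X 0 ω = x k}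

theorem integral_comp_eq_sum {F : Type*} [MeasurableSpace F] [Fintype F]
    [MeasurableSingletonClass F] {μ : Measure Ω} [IsFiniteMeasure μ] {Z : Ω → F}
    (hZ : Measurable Z) (f : F → ℝ) :
    ∫ ω, f (Z ω) ∂μ = ∑ z, μ.real {ω | Z ω = z} * f z := by
  rw [← integral_map hZ.aemeasurable (measurable_of_finite f).aestronglyMeasurable,
    integral_fintype .of_finite]
  exact Finset.sum_congr rfl fun z _ => by
    rw [map_measureReal_apply hZ (measurableSet_singleton z), smul_eq_mul]
    rfl

namespace IsMemorylessChannel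

variable {μ : Measure Ω} {X : ℕ → Ω → S} {Y : ℕ → Ω → T}

theorem isProbabilityMeasure_outputLaw [IsFiniteMeasure μ] (h : IsMemorylessChannel μ X Y) {t : T}
    (ht : μ {ω | Y 0 ω = t} ≠ 0) : IsProbabilityMeasure (outputLaw μ X Y t) :=
  have := cond_isProbabilityMeasure ht
  Measure.isProbabilityMeasure_map (h.measurable_X 0).aemeasurable

theorem outputLaw_real_apply [Finite S] [MeasurableSingletonClass S]
    (h : IsMemorylessChannel μ X Y) (t : T) (B : Set S) :
    (outputLaw μ X Y t).real B = (μ[|{ω | Y 0 ω = t}]).real {ω | X 0 ω ∈ B} :=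
  map_measureReal_apply (h.measurable_X 0) (Set.toFinite B).measurableSet

theorem integrable_block [Finite S] [MeasurableSingletonClass S] [IsFiniteMeasure μ]
    (h : IsMemorylessChannel μ X Y) {n : ℕ} (f : (Fin n → S) → ℝ) :
    Integrable (fun ω => f fun k => X k ω) μ :=
  Integrable.comp_measurable .of_finite (measurable_pi_lambda _ fun k => h.measurable_X k)

variable [Finite T] [MeasurableSingletonClass T]

theorem ae_measure_ne_zero (h : IsMemorylessChannel μ X Y) (k : ℕ) :
    ∀ᵐ ω ∂μ, μ {ω' | Y 0 ω' = Y k ω} ≠ 0 := by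
  refine (h.identDistrib k).symm.ae_snd (p := fun t => μ {ω | Y 0 ω = t} ≠ 0)
    (Set.toFinite _).measurableSet ?_
  have hnull (t : T) : ∀ᵐ ω ∂μ, Y 0 ω = t → μ {ω | Y 0 ω = t} ≠ 0 := by
    by_cases ht : μ {ω | Y 0 ω = t} = 0
    · filter_upwards [measure_eq_zero_iff_ae_notMem.1 ht] with ω hω hωt using (hω hωt).elim
    · exact .of_forall fun _ _ => ht
  filter_upwards [ae_all_iff.2 hnull] with ω hω using hω _ rfl

theorem integral_hitCount [IsProbabilityMeasure μ] (h : IsMemorylessChannel μ X Y) (n : ℕ)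
    (O : Set T) :
    ∫ ω, (hitCount (fun k : Fin n => Y k ω) O : ℝ) ∂μ = n * μ.real {ω | Y 0 ω ∈ O} := by
  have hO : MeasurableSet O := (Set.toFinite O).measurableSet
  have hterm (k : ℕ) : ∫ ω, O.indicator (1 : T → ℝ) (Y k ω) ∂μ = μ.real {ω | Y 0 ω ∈ O} := by
    have hident := (h.identDistrib k).comp (measurable_of_finite (O.indicator (1 : T → ℝ)))
    rw [← Function.comp_def, hident.integral_eq]
    exact integral_indicator_one (h.measurable_Y 0 hO)
  have hint (k : Fin n) : Integrable (fun ω => O.indicator (1 : T → ℝ) (Y k ω)) μ :=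
    (Integrable.of_finite (f := O.indicator (1 : T → ℝ))).comp_measurable (h.measurable_Y k)
  simp_rw [hitCount_eq_sum_indicator]
  rw [integral_finsetSum _ fun k _ => hint k]
  simp [hterm]

variable [Finite S] [MeasurableSingletonClass S]

theorem integral_block [IsFiniteMeasure μ] (h : IsMemorylessChannel μ X Y) {n : ℕ}
    (f : (Fin n → S) → ℝ) :
    ∫ ω, f (fun k => X k ω) ∂μ =
      ∫ ω, ∫ x, f x ∂Measure.pi (fun k : Fin n => outputLaw μ X Y (Y k ω)) ∂μ := by
  cases nonempty_fintype S
  cases nonempty_fintype T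
  have hX : Measurable fun ω (k : Fin n) => X k ω :=
    measurable_pi_lambda _ fun k => h.measurable_X k
  have hY : Measurable fun ω (k : Fin n) => Y k ω :=
    measurable_pi_lambda _ fun k => h.measurable_Y k
  rw [integral_comp_eq_sum hY fun y => ∫ x, f x ∂Measure.pi fun k => outputLaw μ X Y (y k),
    integral_comp_eq_sum (hX.prodMk hY) fun z => f z.1, Fintype.sum_prod_type_right]
  refine Finset.sum_congr rfl fun y _ => ?_
  rw [integral_fintype .of_finite, Finset.mul_sum]
  refine Finset.sum_congr rfl fun x _ => ?_
  have hpi : (Measure.pi fun k => outputLaw μ X Y (y k)).real {x} =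
      ∏ k, (μ[|{ω | Y 0 ω = y k}]).real {ω | X 0 ω = x k} := by
    rw [measureReal_def, Measure.pi_singleton, ENNReal.toReal_prod]
    exact Finset.prod_congr rfl fun k _ => h.outputLaw_real_apply (y k) {x k}
  have hjoint : {ω | ((fun k : Fin n => X k ω), fun k : Fin n => Y k ω) = (x, y)} =
      {ω | ∀ k : Fin n, X k ω = x k ∧ Y k ω = y k} := by
    ext ω
    simp [funext_iff, forall_and]
  rw [hjoint, h.memoryless, hpi, smul_eq_mul, mul_assoc]
  simp only [funext_iff]

theorem integral_empiricalLength_mem_Icc [IsProbabilityMeasure μ] {A : Type*} [Fintype A]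
    (h : IsMemorylessChannel μ X Y)
    {B : A → Set S} (hB : Pairwise (Function.onFun Disjoint B)) {O : Set T} {m : A → ℝ}
    (hm : ∀ t, μ {ω | Y 0 ω = t} ≠ 0 → t ∈ O → ∑ a, m a = 1)
    (hmem : ∀ t, μ {ω | Y 0 ω = t} ≠ 0 → ∀ a,
      (outputLaw μ X Y t).real (B a) = O.indicator (fun _ => m a) t) (n : ℕ) :
    ∫ ω, empiricalLength (fun a => (hitCount (fun k : Fin n => X k ω) (B a) : ℝ)) ∂μ ∈
      Set.Icc (n * (μ.real {ω | Y 0 ω ∈ O} * ∑ a, Real.negMulLog (m a)) - Fintype.card A)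
        (n * (μ.real {ω | Y 0 ω ∈ O} * ∑ a, Real.negMulLog (m a)) + 1) := by
  have hY : Measurable fun ω (k : Fin n) => Y k ω :=
    measurable_pi_lambda _ fun k => h.measurable_Y k
  set η := ∑ a, Real.negMulLog (m a)
  have hcond : ∀ᵐ ω ∂μ,
      ∫ x, empiricalLength (fun a => (hitCount x (B a) : ℝ))
          ∂Measure.pi (fun k : Fin n => outputLaw μ X Y (Y k ω)) ∈
        Set.Icc (hitCount (fun k : Fin n => Y k ω) O * η - Fintype.card A)
          (hitCount (fun k : Fin n => Y k ω) O * η + 1) := by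
    filter_upwards [ae_all_iff.2 h.ae_measure_ne_zero] with ω hω
    have (k : Fin n) := h.isProbabilityMeasure_outputLaw (hω k)
    exact integral_empiricalLength_hitCount_mem_Icc_of_indicator _ hB
      (fun k hk => hm _ (hω k) hk) fun k => hmem _ (hω k)
  have hint (f : (Fin n → T) → ℝ) : Integrable (fun ω => f fun k => Y k ω) μ :=
    Integrable.comp_measurable .of_finite hY
  have hcount (c : ℝ) :
      ∫ ω, (hitCount (fun k : Fin n => Y k ω) O * η + c) ∂μ =
        n * (μ.real {ω | Y 0 ω ∈ O} * η) + c := by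
    rw [integral_add (hint fun y => hitCount y O * η) (integrable_const c), integral_mul_const,
      h.integral_hitCount]
    simp [mul_assoc]
  rw [h.integral_block fun x => empiricalLength fun a => (hitCount x (B a) : ℝ), sub_eq_add_neg,
    ← hcount, ← hcount]
  exact ⟨integral_mono_ae (hint fun y => hitCount y O * η + -(Fintype.card A : ℝ))
      (hint fun y => ∫ x, empiricalLength (fun a => (hitCount x (B a) : ℝ))
        ∂Measure.pi fun k => outputLaw μ X Y (y k)) (hcond.mono fun ω hω => hω.1),
    integral_mono_ae (hint fun y => ∫ x, empiricalLength (fun a => (hitCount x (B a) : ℝ))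
        ∂Measure.pi fun k => outputLaw μ X Y (y k)) (hint fun y => hitCount y O * η + 1)
      (hcond.mono fun ω hω => hω.2)⟩

theorem exists_abs_integral_log_bayesMeasure_le [IsProbabilityMeasure μ] {A : Type*} [Fintype A]
    [Nonempty A] (h : IsMemorylessChannel μ X Y) {B : A → Set S}
    (hB : Pairwise (Function.onFun Disjoint B)) {O : Set T} {m : A → ℝ}
    (hm : ∀ t, μ {ω | Y 0 ω = t} ≠ 0 → t ∈ O → ∑ a, m a = 1)
    (hmem : ∀ t, μ {ω | Y 0 ω = t} ≠ 0 → ∀ a,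
      (outputLaw μ X Y t).real (B a) = O.indicator (fun _ => m a) t) :
    ∃ K : ℝ, ∀ n : ℕ,
      |∫ ω, Real.log (bayesMeasure fun a => hitCount (fun k : Fin n => X k ω) (B a)) ∂μ +
        n * (μ.real {ω | Y 0 ω ∈ O} * ∑ a, Real.negMulLog (m a)) +
        ((Fintype.card A : ℝ) - 1) / 2 *
          ∫ ω, Real.log (hitCount (fun k : Fin n => X k ω) (⋃ a, B a)) ∂μ| ≤ K := by
  obtain ⟨K, hK⟩ := exists_abs_log_bayesMeasure_le A
  refine ⟨K + Fintype.card A, fun n => ?_⟩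
  have hcard : (1 : ℝ) ≤ Fintype.card A := by exact_mod_cast Fintype.card_pos
  have hlen := h.integral_empiricalLength_mem_Icc hB hm hmem n
  let bayes (x : Fin n → S) : ℝ := Real.log (bayesMeasure fun a => hitCount x (B a))
  let len (x : Fin n → S) : ℝ := empiricalLength fun a => (hitCount x (B a) : ℝ)
  let size (x : Fin n → S) : ℝ :=
    ((Fintype.card A : ℝ) - 1) / 2 * Real.log (hitCount x (⋃ a, B a))
  have herror (x : Fin n → S) : |bayes x + len x + size x| ≤ K := by
    have := hK fun a => hitCount x (B a)
    rwa [sum_hitCount x hB] at this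
  have hmean :
      |∫ ω, (bayes (fun k => X k ω) + len (fun k => X k ω) + size fun k => X k ω) ∂μ| ≤ K := by
    have hbound : ∀ᵐ ω ∂μ, ‖bayes (fun k => X k ω) + len (fun k => X k ω) +
        size fun k => X k ω‖ ≤ K := .of_forall fun ω => herror fun k => X k ω
    simpa using norm_integral_le_of_norm_le_const hbound
  rw [integral_add (h.integrable_block fun x => bayes x + len x) (h.integrable_block size),
    integral_add (h.integrable_block bayes) (h.integrable_block len), integral_const_mul,
    abs_le] at hmean
  rw [abs_le]
  constructor <;> linarith [hlen.1, hlen.2]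

end IsMemorylessChannel

theorem IsIncompleteSource.isMemorylessChannel {p : ℕ} {α : Fin p → ℕ} {μ : Measure Ω}
    {X : ℕ → Ω → Row α} {Y : ℕ → Ω → Fin p → Bool} (h : IsIncompleteSource μ X Y) :
    IsMemorylessChannel μ X Y where
  measurable_X := h.measurable_X
  measurable_Y := h.measurable_Y
  memoryless := h.memoryless
  identDistrib k := by
    refine ⟨(h.measurable_Y k).aemeasurable, (h.measurable_Y 0).aemeasurable, ?_⟩
    have hY : Measurable fun ω k => Y k ω := measurable_pi_lambda _ h.measurable_Y
    have hmap (k : ℕ) : (μ.map fun ω k => Y k ω).map (fun y => y k) = μ.map (Y k) :=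
      Measure.map_map (measurable_pi_apply k) hY
    induction k with
    | zero => rfl
    | succ k ih =>
      calc μ.map (Y (k + 1)) = (μ.map fun ω k => Y k ω).map (fun y => y (k + 1)) := (hmap _).symm
        _ = ((μ.map fun ω k => Y k ω).map fun y k => y (k + 1)).map (fun y => y k) :=
          (Measure.map_map (measurable_pi_apply k) h.ergodic.measurable).symm
        _ = μ.map (Y k) := by rw [h.ergodic.toMeasurePreserving.map_eq, hmap]
        _ = μ.map (Y 0) := ih

end Channel

section Laws

variable {p : ℕ} {α : Fin p → ℕ} {Ω : Type*} [MeasurableSpace Ω] {μ : Measure Ω}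
  {X : ℕ → Ω → Row α} {Y : ℕ → Ω → Fin p → Bool} {i j : Fin p} {y : Fin p → Bool}

theorem sum_measureReal_and_eq {F : Type*} [MeasurableSpace F] [MeasurableSingletonClass F]
    [Fintype F] {ν : Measure Ω} [IsFiniteMeasure ν] {Z : Ω → F} (hZ : Measurable Z)
    (q : Ω → Prop) : ∑ z, ν.real {ω | q ω ∧ Z ω = z} = ν.real {ω | q ω} := by
  have h := sum_measureReal_preimage_singleton (μ := ν.restrict {ω | q ω}) Finset.univ
    fun z _ => hZ (measurableSet_singleton z)
  rw [Finset.coe_univ, Set.preimage_univ, measureReal_restrict_apply .univ, Set.univ_inter] at h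
  rw [← h]
  refine Finset.sum_congr rfl fun z _ => ?_
  rw [measureReal_restrict_apply (hZ (measurableSet_singleton z)), Set.inter_comm]
  rfl

theorem cond_real_congr {C B B' : Set Ω} (hC : MeasurableSet C)
    (h : ∀ ω ∈ C, ω ∈ B ↔ ω ∈ B') : (μ[|C]).real B = (μ[|C]).real B' := by
  have hinter : C ∩ B = C ∩ B' := by
    ext ω
    exact and_congr_right (h ω)
  rw [measureReal_def, measureReal_def, cond_apply hC, cond_apply hC, hinter]

theorem measure_ne_zero_of_pattern (hy : μ {ω | Y 0 ω = y} ≠ 0) {q : (Fin p → Bool) → Prop}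
    (hq : q y) : μ {ω | q (Y 0 ω)} ≠ 0 := fun h =>
  hy (measure_mono_null (fun ω (hω : Y 0 ω = y) => show q (Y 0 ω) from hω ▸ hq) h)

theorem P_eq_P₂ (i : Fin p) (a : Fin (α i + 1)) : P μ X Y i a = P₂ μ X Y i i a a := by
  simp only [P, P₂, and_self]

theorem P₂_comm (i j : Fin p) (a : Fin (α i + 1)) (b : Fin (α j + 1)) :
    P₂ μ X Y j i b a = P₂ μ X Y i j a b := by
  simp only [P₂, and_comm]

theorem P₂_nonneg (a : Fin (α i + 1)) (b : Fin (α j + 1)) : 0 ≤ P₂ μ X Y i j a b :=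
  measureReal_nonneg

theorem PatternFree.symm (h : PatternFree μ X Y i j) : PatternFree μ X Y j i := by
  intro y hj hi hy b a
  rw [P₂_comm, ← h y hi hj hy a b]
  simp only [and_comm]

theorem PatternFree.cond_real_eq_P (h : PatternFree μ X Y i i) (hi : y i = true)
    (hy : μ {ω | Y 0 ω = y} ≠ 0) (a : Fin (α i + 1)) :
    (μ[|{ω | Y 0 ω = y}]).real {ω | X 0 ω i = a} = P μ X Y i a := by
  simpa only [P_eq_P₂, and_self] using h y hi hi hy a a

namespace IsMemorylessChannel

theorem measurable_entry (h : IsMemorylessChannel μ X Y) (i : Fin p) :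
    Measurable fun ω => X 0 ω i :=
  (measurable_pi_apply i).comp (h.measurable_X 0)

theorem measurableSet_pattern (h : IsMemorylessChannel μ X Y) (q : (Fin p → Bool) → Prop) :
    MeasurableSet {ω | q (Y 0 ω)} :=
  h.measurable_Y 0 (Set.toFinite {y | q y}).measurableSet

theorem P₂_last_left (h : IsMemorylessChannel μ X Y)
    (hmiss : ∀ ω i, X 0 ω i = Fin.last (α i) ↔ Y 0 ω i = false) (b : Fin (α j + 1)) :
    P₂ μ X Y i j (Fin.last _) b = 0 := by
  rw [P₂, cond_real_congr (B' := ∅) (h.measurableSet_pattern fun y => y i = true ∧ y j = true)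
    fun ω hω => ?_, measureReal_empty]
  simp [hmiss, hω.1]

theorem P_last (h : IsMemorylessChannel μ X Y)
    (hmiss : ∀ ω i, X 0 ω i = Fin.last (α i) ↔ Y 0 ω i = false) :
    P μ X Y i (Fin.last _) = 0 := by
  rw [P_eq_P₂, h.P₂_last_left hmiss]

theorem sum_P₂ (h : IsMemorylessChannel μ X Y) (i j : Fin p) (a : Fin (α i + 1)) :
    ∑ b, P₂ μ X Y i j a b = Psub μ X Y i j a :=
  sum_measureReal_and_eq (h.measurable_entry j) _

theorem Psub_eq_P (h : IsMemorylessChannel μ X Y) (hy : μ {ω | Y 0 ω = y} ≠ 0)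
    (hi : y i = true) (hj : y j = true) (hii : PatternFree μ X Y i i)
    (hij : PatternFree μ X Y i j) (a : Fin (α i + 1)) : Psub μ X Y i j a = P μ X Y i a := by
  rw [← h.sum_P₂, ← hii.cond_real_eq_P hi hy]
  simp_rw [← hij y hi hj hy a]
  exact sum_measureReal_and_eq (h.measurable_entry j) _

theorem P₂_eq_zero_of_Psub (h : IsMemorylessChannel μ X Y) {a : Fin (α i + 1)}
    (ha : Psub μ X Y i j a = 0) (b : Fin (α j + 1)) : P₂ μ X Y i j a b = 0 := by
  rw [← h.sum_P₂, Finset.sum_eq_zero_iff_of_nonneg fun b _ => P₂_nonneg a b] at ha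
  exact ha b (Finset.mem_univ b)

theorem sum_P [IsFiniteMeasure μ] (h : IsMemorylessChannel μ X Y)
    (hy : μ {ω | Y 0 ω = y} ≠ 0) (hi : y i = true) : ∑ a, P μ X Y i a = 1 := by
  have := cond_isProbabilityMeasure (measure_ne_zero_of_pattern hy (q := fun y => y i = true) hi)
  simpa [P] using sum_measureReal_and_eq (ν := μ[|{ω | Y 0 ω i = true}]) (h.measurable_entry i)
    fun _ => True

theorem r₂_mul_I_eq [IsFiniteMeasure μ] (h : IsMemorylessChannel μ X Y)
    (hi : PatternFree μ X Y i i) (hj : PatternFree μ X Y j j) (hij : PatternFree μ X Y i j) :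
    r₂ μ Y i j * I μ X Y i j = r₂ μ Y i j *
      (H μ X Y i + H μ X Y j - ∑ a, ∑ b, Real.negMulLog (P₂ μ X Y i j a b)) := by
  by_cases hr : r₂ μ Y i j = 0
  · rw [hr, zero_mul, zero_mul]
  obtain ⟨y, hyi, hyj, hy⟩ : ∃ y, y i = true ∧ y j = true ∧ μ {ω | Y 0 ω = y} ≠ 0 := by
    by_contra! hnull
    refine hr ((measureReal_eq_zero_iff).2 (measure_mono_null (t := ⋃ y : {y : Fin p → Bool //
      y i = true ∧ y j = true}, {ω | Y 0 ω = y}) (fun ω hω => ?_) ?_))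
    · exact Set.mem_iUnion.2 ⟨⟨Y 0 ω, hω⟩, rfl⟩
    · exact measure_iUnion_null fun y => hnull y y.2.1 y.2.2
  have hsub := h.Psub_eq_P hy hyi hyj hi hij
  have hsub' := h.Psub_eq_P hy hyj hyi hj hij.symm
  rw [I, sum_mul_log_div_eq P₂_nonneg (h.sum_P₂ i j) fun b => by
    simpa only [P₂_comm] using h.sum_P₂ j i b]
  simp only [hsub, hsub', H]

end IsMemorylessChannel

end Laws

section ConditionalEntropy

variable {p : ℕ} {α : Fin p → ℕ} {Ω : Type*} [MeasurableSpace Ω] {μ : Measure Ω}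
  {X : ℕ → Ω → Row α} {Y : ℕ → Ω → Fin p → Bool} {y : Fin p → Bool} {x : Row α}
  {E : Finset (Fin p × Fin p)} {e : Fin p × Fin p}

/-- The law of entry `i` of a sample with missingness pattern `y`: the point mass at the missing
value if `y i = false`. With this convention `P'(· | y)` is a forest weight on all of `Row α`. -/
noncomputable def patternMarginal (μ : Measure Ω) (X : ℕ → Ω → Row α) (Y : ℕ → Ω → Fin p → Bool)
    (y : Fin p → Bool) (i : Fin p) : Fin (α i + 1) → ℝ :=
  if y i = true then P μ X Y i else Pi.single (Fin.last (α i)) 1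

/-- The density `P_ij / (P_i P_j)` of the joint law of the two ends of an edge `e` with respect to
the product of its marginals, equal to `0` where that product vanishes. -/
noncomputable def edgeDensity (μ : Measure Ω) (X : ℕ → Ω → Row α) (Y : ℕ → Ω → Fin p → Bool)
    (e : Fin p × Fin p) (a : Fin (α e.1 + 1)) (b : Fin (α e.2 + 1)) : ℝ :=
  P₂ μ X Y e.1 e.2 a b / (P μ X Y e.1 a * P μ X Y e.2 b)

/-- The edges of `E` whose ends are both observed under the missingness pattern `y`. -/
def observedEdges (E : Finset (Fin p × Fin p)) (y : Fin p → Bool) : Finset (Fin p × Fin p) :=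
  E.filter fun e => y e.1 = true ∧ y e.2 = true

theorem mem_observedEdges : e ∈ observedEdges E y ↔ e ∈ E ∧ y e.1 = true ∧ y e.2 = true :=
  Finset.mem_filter

theorem P'_eq_forestWeight (hx : ∀ i, x i = Fin.last (α i) ↔ y i = false) :
    P' μ X Y E x y =
      forestWeight (patternMarginal μ X Y y) (edgeDensity μ X Y) (observedEdges E y) x := by
  rw [P', forestWeight, observedEdges, Finset.prod_filter]
  congr 1
  · refine Finset.prod_congr rfl fun i _ => ?_
    cases hi : y i
    · simp [patternMarginal, hi, (hx i).2 hi]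
    · simp [patternMarginal, hi]
  · refine Finset.prod_congr rfl fun e _ => ?_
    cases h₁ : y e.1 <;> cases h₂ : y e.2 <;> simp [edgeDensity]

theorem sum_negMulLog_patternMarginal (i : Fin p) :
    ∑ a, Real.negMulLog (patternMarginal μ X Y y i a) =
      if y i = true then H μ X Y i else 0 := by
  split_ifs with hi
  · rw [patternMarginal, if_pos hi, H]
  · rw [patternMarginal, if_neg hi]
    refine Finset.sum_eq_zero fun a _ => ?_
    rcases eq_or_ne a (Fin.last (α i)) with rfl | ha
    · rw [Pi.single_eq_same, Real.negMulLog_one]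
    · rw [Pi.single_eq_of_ne ha, Real.negMulLog_zero]

namespace IsMemorylessChannel

theorem sum_patternMarginal [IsFiniteMeasure μ] (h : IsMemorylessChannel μ X Y)
    (hy : μ {ω | Y 0 ω = y} ≠ 0) (i : Fin p) : ∑ a, patternMarginal μ X Y y i a = 1 := by
  rw [patternMarginal]
  split_ifs with hi
  · exact h.sum_P hy hi
  · exact Fintype.sum_pi_single' _ _

theorem forestWeight_patternMarginal_eq_zero (h : IsMemorylessChannel μ X Y)
    (hmiss : ∀ ω i, X 0 ω i = Fin.last (α i) ↔ Y 0 ω i = false)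
    {g : ∀ e : Fin p × Fin p, Fin (α e.1 + 1) → Fin (α e.2 + 1) → ℝ}
    {D : Finset (Fin p × Fin p)} (hx : ¬ ∀ i, x i = Fin.last (α i) ↔ y i = false) :
    forestWeight (patternMarginal μ X Y y) g D x = 0 := by
  obtain ⟨i, hi⟩ := not_forall.1 hx
  refine forestWeight_eq_zero (i := i) ?_
  rw [patternMarginal]
  split_ifs with hyi
  · have hlast : x i = Fin.last (α i) := by simpa [hyi] using hi
    rw [hlast, h.P_last hmiss]
  · have hlast : x i ≠ Fin.last (α i) := by simpa [hyi] using hi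
    exact Pi.single_eq_of_ne hlast _

variable (hV : ∀ i, PatternFree μ X Y i i) (hP : ∀ e ∈ E, PatternFree μ X Y e.1 e.2)

include hV hP

theorem Psub_eq_patternMarginal (h : IsMemorylessChannel μ X Y) (hy : μ {ω | Y 0 ω = y} ≠ 0)
    (he : e ∈ observedEdges E y) :
    Psub μ X Y e.1 e.2 = patternMarginal μ X Y y e.1 ∧
      Psub μ X Y e.2 e.1 = patternMarginal μ X Y y e.2 := by
  obtain ⟨heE, h₁, h₂⟩ := mem_observedEdges.1 he
  rw [patternMarginal, patternMarginal, if_pos h₁, if_pos h₂]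
  exact ⟨funext (h.Psub_eq_P hy h₁ h₂ (hV _) (hP e heE)),
    funext (h.Psub_eq_P hy h₂ h₁ (hV _) (hP e heE).symm)⟩

theorem patternMarginal_mul_edgeDensity (h : IsMemorylessChannel μ X Y)
    (hy : μ {ω | Y 0 ω = y} ≠ 0) (he : e ∈ observedEdges E y) (a : Fin (α e.1 + 1))
    (b : Fin (α e.2 + 1)) :
    patternMarginal μ X Y y e.1 a * patternMarginal μ X Y y e.2 b * edgeDensity μ X Y e a b =
      P₂ μ X Y e.1 e.2 a b := by
  have hsub := h.Psub_eq_patternMarginal hV hP hy he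
  obtain ⟨-, h₁, h₂⟩ := mem_observedEdges.1 he
  rw [patternMarginal, patternMarginal, if_pos h₁, if_pos h₂] at hsub ⊢
  rw [edgeDensity]
  refine mul_div_cancel_of_imp' fun hzero => ?_
  rcases mul_eq_zero.1 hzero with ha | hb
  · exact h.P₂_eq_zero_of_Psub (by rwa [hsub.1]) b
  · rw [← P₂_comm]
    exact h.P₂_eq_zero_of_Psub (by rwa [hsub.2]) a

theorem isCoupling_patternMarginal (h : IsMemorylessChannel μ X Y)
    (hy : μ {ω | Y 0 ω = y} ≠ 0) :
    IsCoupling (patternMarginal μ X Y y) (edgeDensity μ X Y) (observedEdges E y) := by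
  intro e he
  have hsub := h.Psub_eq_patternMarginal hV hP hy he
  have hmul := h.patternMarginal_mul_edgeDensity hV hP hy he
  refine ⟨fun a ha => mul_left_cancel₀ ha ?_,
    fun (b : Fin (α e.2 + 1)) hb => mul_left_cancel₀ hb ?_⟩
  · simp_rw [Finset.mul_sum, ← mul_assoc, hmul, h.sum_P₂, hsub.1, mul_one]
  · simp_rw [Finset.mul_sum, ← mul_assoc, mul_comm (patternMarginal μ X Y y e.2 b), hmul,
      ← P₂_comm e.1 e.2, h.sum_P₂, hsub.2, one_mul]

theorem sum_negMulLog_P' [IsFiniteMeasure μ] (h : IsMemorylessChannel μ X Y)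
    (hmiss : ∀ ω i, X 0 ω i = Fin.last (α i) ↔ Y 0 ω i = false) (hE : IsForest E)
    (hy : μ {ω | Y 0 ω = y} ≠ 0) :
    ∑ x : Row α with ∀ i, x i = Fin.last (α i) ↔ y i = false,
        Real.negMulLog (P' μ X Y E x y) =
      ∑ i, (if y i = true then H μ X Y i else 0) -
        ∑ e ∈ E, if y e.1 = true ∧ y e.2 = true then I μ X Y e.1 e.2 else 0 := by
  have hweight : ∑ x : Row α with ∀ i, x i = Fin.last (α i) ↔ y i = false,
      Real.negMulLog (P' μ X Y E x y) = ∑ x, Real.negMulLog (forestWeight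
        (patternMarginal μ X Y y) (edgeDensity μ X Y) (observedEdges E y) x) := by
    rw [Finset.sum_filter]
    refine Finset.sum_congr rfl fun x _ => ?_
    split_ifs with hx
    · rw [P'_eq_forestWeight hx]
    · rw [h.forestWeight_patternMarginal_eq_zero hmiss hx, Real.negMulLog_zero]
  have hD : IsForest (observedEdges E y) := hE.subset (Finset.filter_subset _ _)
  rw [hweight, sum_negMulLog_forestWeight (h.sum_patternMarginal hy) hD
    (h.isCoupling_patternMarginal hV hP hy),
    ← Finset.sum_filter (s := E), ← observedEdges]
  congr 1
  · exact Finset.sum_congr rfl fun i _ => sum_negMulLog_patternMarginal i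
  · refine Finset.sum_congr rfl fun e he => ?_
    have hsub := h.Psub_eq_patternMarginal hV hP hy he
    obtain ⟨-, h₁, h₂⟩ := mem_observedEdges.1 he
    simp_rw [h.patternMarginal_mul_edgeDensity hV hP hy he]
    rw [patternMarginal, patternMarginal, if_pos h₁, if_pos h₂] at hsub
    simp only [I, edgeDensity, hsub]

theorem condEntropy_eq [IsFiniteMeasure μ] (h : IsMemorylessChannel μ X Y)
    (hmiss : ∀ ω i, X 0 ω i = Fin.last (α i) ↔ Y 0 ω i = false) (hE : IsForest E) :
    condEntropy μ X Y E =
      ∑ i, r μ Y i * H μ X Y i - ∑ e ∈ E, r₂ μ Y e.1 e.2 * I μ X Y e.1 e.2 := by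
  have hterm (q : (Fin p → Bool) → Prop) [DecidablePred q] (c : ℝ) :
      Integrable (fun ω => if q (Y 0 ω) then c else 0) μ ∧
        ∫ ω, (if q (Y 0 ω) then c else 0) ∂μ = μ.real {ω | q (Y 0 ω)} * c := by
    have hind : (fun ω => if q (Y 0 ω) then c else 0) =
        {ω | q (Y 0 ω)}.indicator fun _ => c := by
      ext ω
      simp only [Set.indicator_apply, Set.mem_ofPred_eq]
    rw [hind, integral_indicator_const c (h.measurableSet_pattern q), smul_eq_mul]
    exact ⟨(integrable_const c).indicator (h.measurableSet_pattern q), rfl⟩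
  have hentry (i : Fin p) := hterm (fun y => y i = true) (H μ X Y i)
  have hedge (e : Fin p × Fin p) :=
    hterm (fun y => y e.1 = true ∧ y e.2 = true) (I μ X Y e.1 e.2)
  rw [condEntropy, ← integral_comp_eq_sum (h.measurable_Y 0) fun y =>
    ∑ x : Row α with ∀ i, x i = Fin.last (α i) ↔ y i = false, Real.negMulLog (P' μ X Y E x y)]
  calc _ = ∫ ω, (∑ i, (if Y 0 ω i = true then H μ X Y i else 0) -
        ∑ e ∈ E, if Y 0 ω e.1 = true ∧ Y 0 ω e.2 = true then I μ X Y e.1 e.2 else 0) ∂μ := by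
        refine integral_congr_ae ?_
        filter_upwards [h.ae_measure_ne_zero 0] with ω hω
          using h.sum_negMulLog_P' hV hP hmiss hE hω
    _ = _ := by
        rw [integral_sub (integrable_finsetSum _ fun i _ => (hentry i).1)
          (integrable_finsetSum _ fun e _ => (hedge e).1),
          integral_finsetSum _ fun i _ => (hentry i).1,
          integral_finsetSum _ fun e _ => (hedge e).1]
        simp only [hentry, hedge, r, r₂]

end IsMemorylessChannel

end ConditionalEntropy

section Redundancy

variable {p : ℕ} {α : Fin p → ℕ} {n : ℕ}

theorem Q_eq_bayesMeasure_hitCount (x : Fin n → Row α) (i : Fin p) :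
    Q x i = bayesMeasure fun a : Fin (α i) => hitCount x {s | s i = a.castSucc} := by
  classical
  refine congrArg bayesMeasure (funext fun a => ?_)
  rw [obs, Finset.filter_filter, hitCount]
  congr! 2 with k
  exact and_iff_right_of_imp fun h => h ▸ Fin.castSucc_ne_last a

theorem Qsub_eq_bayesMeasure_hitCount (x : Fin n → Row α) (i j : Fin p) :
    Qsub x i j = bayesMeasure fun a : Fin (α i) =>
      hitCount x {s | s i = a.castSucc ∧ s j ≠ Fin.last (α j)} := by
  classical
  refine congrArg bayesMeasure (funext fun a => ?_)
  rw [obs₂, Finset.filter_filter, hitCount]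
  congr! 2 with k
  exact ⟨fun h => ⟨h.2, h.1.2⟩, fun h => ⟨⟨h.1 ▸ Fin.castSucc_ne_last a, h.2⟩, h.1⟩⟩

theorem Qpair_eq_bayesMeasure_hitCount (x : Fin n → Row α) (i j : Fin p) :
    Qpair x i j = bayesMeasure fun ab : Fin (α i) × Fin (α j) =>
      hitCount x {s | s i = ab.1.castSucc ∧ s j = ab.2.castSucc} := by
  classical
  refine congrArg bayesMeasure (funext fun ab => ?_)
  rw [obs₂, Finset.filter_filter, hitCount]
  congr! 2 with k
  exact and_iff_right_of_imp fun h =>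
    ⟨h.1 ▸ Fin.castSucc_ne_last ab.1, h.2 ▸ Fin.castSucc_ne_last ab.2⟩

theorem card_obs (x : Fin n → Row α) (i : Fin p) :
    (obs x i).card = hitCount x (⋃ a : Fin (α i), {s | s i = a.castSucc}) := by
  rw [obs, hitCount]
  congr! 2 with k
  simp [← Fin.exists_castSucc_eq, eq_comm]

theorem card_obs₂_eq_hitCount_iUnion_left (x : Fin n → Row α) (i j : Fin p) :
    (obs₂ x i j).card =
      hitCount x (⋃ a : Fin (α i), {s | s i = a.castSucc ∧ s j ≠ Fin.last (α j)}) := by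
  rw [obs₂, hitCount]
  congr! 2 with k
  simp [← Fin.exists_castSucc_eq, eq_comm]

theorem card_obs₂_eq_hitCount_iUnion_prod (x : Fin n → Row α) (i j : Fin p) :
    (obs₂ x i j).card = hitCount x
      (⋃ ab : Fin (α i) × Fin (α j), {s | s i = ab.1.castSucc ∧ s j = ab.2.castSucc}) := by
  rw [obs₂, hitCount]
  congr! 2 with k
  simp [← Fin.exists_castSucc_eq, eq_comm]

theorem obs₂_comm (x : Fin n → Row α) (i j : Fin p) : obs₂ x j i = obs₂ x i j := by
  simp only [obs₂, and_comm]

theorem log_R (hα : ∀ i, 0 < α i) (x : Fin n → Row α) (E : Finset (Fin p × Fin p)) :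
    Real.log (R x E) = ∑ i, Real.log (Q x i) +
      ∑ e ∈ E, Real.log (Qpair x e.1 e.2 / (Qsub x e.1 e.2 * Qsub x e.2 e.1)) := by
  have (i : Fin p) : Nonempty (Fin (α i)) := Fin.pos_iff_nonempty.1 (hα i)
  have hQ (i : Fin p) : Q x i ≠ 0 := (bayesMeasure_pos _).ne'
  have hratio (e : Fin p × Fin p) : Qpair x e.1 e.2 / (Qsub x e.1 e.2 * Qsub x e.2 e.1) ≠ 0 :=
    (div_pos (bayesMeasure_pos _) (mul_pos (bayesMeasure_pos _) (bayesMeasure_pos _))).ne'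
  rw [R, Real.log_mul (Finset.prod_ne_zero_iff.2 fun i _ => hQ i)
    (Finset.prod_ne_zero_iff.2 fun e _ => hratio e), Real.log_prod fun i _ => hQ i,
    Real.log_prod fun e _ => hratio e]

theorem IsChowLiu.descriptionLength_le (hα : ∀ i, 0 < α i) (hn : 1 ≤ n) {x : Fin n → Row α}
    {E E' : Finset (Fin p × Fin p)} (hE' : IsChowLiu (J x) E') (hE : IsForest E) :
    descriptionLength x E' ≤ descriptionLength x E := by
  have hweight := hE'.weight_le hE
  simp only [J, ← Finset.mul_sum] at hweight
  have hsum := le_of_mul_le_mul_left hweight (by positivity)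
  rw [descriptionLength, descriptionLength, log_R hα, log_R hα]
  linarith

variable {Ω : Type*} [MeasurableSpace Ω] {μ : Measure Ω} {X : ℕ → Ω → Row α}
  {Y : ℕ → Ω → Fin p → Bool} {i j : Fin p} {y : Fin p → Bool} {E : Finset (Fin p × Fin p)}

namespace IsMemorylessChannel

theorem outputLaw_real_eq_zero (h : IsMemorylessChannel μ X Y)
    (hmiss : ∀ ω i, X 0 ω i = Fin.last (α i) ↔ Y 0 ω i = false) (hi : ¬ y i = true)
    {B : Set (Row α)} (hB : ∀ s ∈ B, s i ≠ Fin.last (α i)) : (outputLaw μ X Y y).real B = 0 := by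
  rw [h.outputLaw_real_apply, cond_real_congr (B' := ∅)
    (h.measurableSet_pattern fun z => z = y) fun ω hω => ?_, measureReal_empty]
  have hYω : Y 0 ω = y := hω
  refine iff_of_false (fun hmem => hB _ hmem ((hmiss ω i).2 ?_)) (Set.notMem_empty ω)
  rw [hYω]
  exact Bool.eq_false_iff.2 hi

theorem sum_P_castSucc [IsFiniteMeasure μ] (h : IsMemorylessChannel μ X Y)
    (hmiss : ∀ ω i, X 0 ω i = Fin.last (α i) ↔ Y 0 ω i = false)
    (hy : μ {ω | Y 0 ω = y} ≠ 0) (hi : y i = true) :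
    ∑ a : Fin (α i), P μ X Y i a.castSucc = 1 := by
  rw [← h.sum_P hy hi, Fin.sum_univ_castSucc, h.P_last hmiss, add_zero]

theorem H_eq_sum_castSucc (h : IsMemorylessChannel μ X Y)
    (hmiss : ∀ ω i, X 0 ω i = Fin.last (α i) ↔ Y 0 ω i = false) (i : Fin p) :
    H μ X Y i = ∑ a : Fin (α i), Real.negMulLog (P μ X Y i a.castSucc) := by
  rw [H, Fin.sum_univ_castSucc, h.P_last hmiss, Real.negMulLog_zero, add_zero]

theorem sum_comp_P₂_castSucc (h : IsMemorylessChannel μ X Y)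
    (hmiss : ∀ ω i, X 0 ω i = Fin.last (α i) ↔ Y 0 ω i = false) {f : ℝ → ℝ} (hf : f 0 = 0)
    (i j : Fin p) :
    ∑ ab : Fin (α i) × Fin (α j), f (P₂ μ X Y i j ab.1.castSucc ab.2.castSucc) =
      ∑ a, ∑ b, f (P₂ μ X Y i j a b) := by
  have hlast (a : Fin (α i + 1)) : P₂ μ X Y i j a (Fin.last _) = 0 := by
    rw [← P₂_comm, h.P₂_last_left hmiss]
  simp only [Fintype.sum_prod_type, Fin.sum_univ_castSucc, h.P₂_last_left hmiss, hlast, hf,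
    Finset.sum_const_zero, add_zero]

theorem integrable_frame [IsFiniteMeasure μ] (h : IsMemorylessChannel μ X Y) {n : ℕ}
    (f : (Fin n → Row α) → ℝ) : Integrable (fun ω => f (frame X n ω)) μ :=
  h.integrable_block f

variable [IsProbabilityMeasure μ]

theorem exists_abs_integral_log_Q_le (hα : 0 < α i) (h : IsMemorylessChannel μ X Y)
    (hmiss : ∀ ω i, X 0 ω i = Fin.last (α i) ↔ Y 0 ω i = false) (hi : PatternFree μ X Y i i) :
    ∃ K : ℝ, ∀ n : ℕ, |∫ ω, Real.log (Q (frame X n ω) i) ∂μ + n * (r μ Y i * H μ X Y i) +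
      ((α i : ℝ) - 1) / 2 * ∫ ω, Real.log (obs (frame X n ω) i).card ∂μ| ≤ K := by
  have : Nonempty (Fin (α i)) := Fin.pos_iff_nonempty.1 hα
  have hdisj : Pairwise (Function.onFun Disjoint
      fun a : Fin (α i) => {s : Row α | s i = a.castSucc}) := fun a b hab =>
    Set.disjoint_left.2 fun s hs hs' => hab (Fin.castSucc_injective _ (hs.symm.trans hs'))
  simp only [Q_eq_bayesMeasure_hitCount, card_obs, h.H_eq_sum_castSucc hmiss]
  convert h.exists_abs_integral_log_bayesMeasure_le hdisj (O := {y | y i = true})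
    (fun y hy hyi => h.sum_P_castSucc hmiss hy hyi) fun y hy a => ?_ using 3
  · rw [Fintype.card_fin]
    rfl
  by_cases hyi : y i = true
  · rw [Set.indicator_of_mem (show y ∈ {y | y i = true} from hyi), h.outputLaw_real_apply]
    exact hi.cond_real_eq_P hyi hy _
  · rw [Set.indicator_of_notMem (show y ∉ {y | y i = true} from hyi)]
    exact h.outputLaw_real_eq_zero hmiss hyi fun s hs => hs ▸ Fin.castSucc_ne_last a

theorem exists_abs_integral_log_Qsub_le (hα : 0 < α i) (h : IsMemorylessChannel μ X Y)
    (hmiss : ∀ ω i, X 0 ω i = Fin.last (α i) ↔ Y 0 ω i = false) (hi : PatternFree μ X Y i i)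
    (j : Fin p) :
    ∃ K : ℝ, ∀ n : ℕ, |∫ ω, Real.log (Qsub (frame X n ω) i j) ∂μ +
      n * (r₂ μ Y i j * H μ X Y i) +
      ((α i : ℝ) - 1) / 2 * ∫ ω, Real.log (obs₂ (frame X n ω) i j).card ∂μ| ≤ K := by
  have : Nonempty (Fin (α i)) := Fin.pos_iff_nonempty.1 hα
  let B (a : Fin (α i)) : Set (Row α) := {s | s i = a.castSucc ∧ s j ≠ Fin.last (α j)}
  let O : Set (Fin p → Bool) := {y | y i = true ∧ y j = true}
  have hdisj : Pairwise (Function.onFun Disjoint B) := fun a b hab =>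
    Set.disjoint_left.2 fun s hs hs' => hab (Fin.castSucc_injective _ (hs.1.symm.trans hs'.1))
  have hmem (y : Fin p → Bool) (hy : μ {ω | Y 0 ω = y} ≠ 0) (a : Fin (α i)) :
      (outputLaw μ X Y y).real (B a) = O.indicator (fun _ => P μ X Y i a.castSucc) y := by
    by_cases hyO : y ∈ O
    · rw [Set.indicator_of_mem hyO, h.outputLaw_real_apply, ← hi.cond_real_eq_P hyO.1 hy]
      refine cond_real_congr (h.measurableSet_pattern fun z => z = y) fun ω hω => ?_
      have hYω : Y 0 ω = y := hω
      exact and_iff_left_of_imp fun _ => (hmiss ω j).not.2 (by simp [hYω, hyO.2])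
    · rw [Set.indicator_of_notMem hyO]
      rcases not_and_or.1 hyO with hyi | hyj
      · exact h.outputLaw_real_eq_zero hmiss hyi fun s hs => hs.1 ▸ Fin.castSucc_ne_last a
      · exact h.outputLaw_real_eq_zero hmiss hyj fun s hs => hs.2
  have hbayes := h.exists_abs_integral_log_bayesMeasure_le hdisj
    (fun y hy hyO => h.sum_P_castSucc hmiss hy hyO.1) hmem
  simp only [Qsub_eq_bayesMeasure_hitCount, card_obs₂_eq_hitCount_iUnion_left,
    h.H_eq_sum_castSucc hmiss]
  rwa [Fintype.card_fin] at hbayes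

theorem exists_abs_integral_log_Qpair_le (hi : 0 < α i) (hj : 0 < α j)
    (h : IsMemorylessChannel μ X Y)
    (hmiss : ∀ ω i, X 0 ω i = Fin.last (α i) ↔ Y 0 ω i = false) (hij : PatternFree μ X Y i j) :
    ∃ K : ℝ, ∀ n : ℕ, |∫ ω, Real.log (Qpair (frame X n ω) i j) ∂μ +
      n * (r₂ μ Y i j * ∑ a, ∑ b, Real.negMulLog (P₂ μ X Y i j a b)) +
      ((α i : ℝ) * α j - 1) / 2 * ∫ ω, Real.log (obs₂ (frame X n ω) i j).card ∂μ| ≤ K := by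
  have : Nonempty (Fin (α i)) := Fin.pos_iff_nonempty.1 hi
  have : Nonempty (Fin (α j)) := Fin.pos_iff_nonempty.1 hj
  let B (ab : Fin (α i) × Fin (α j)) : Set (Row α) :=
    {s | s i = ab.1.castSucc ∧ s j = ab.2.castSucc}
  let O : Set (Fin p → Bool) := {y | y i = true ∧ y j = true}
  let m (ab : Fin (α i) × Fin (α j)) : ℝ := P₂ μ X Y i j ab.1.castSucc ab.2.castSucc
  have hdisj : Pairwise (Function.onFun Disjoint B) := fun ab ab' hab =>
    Set.disjoint_left.2 fun s hs hs' => hab (Prod.ext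
      (Fin.castSucc_injective _ (hs.1.symm.trans hs'.1))
      (Fin.castSucc_injective _ (hs.2.symm.trans hs'.2)))
  have hsum (y : Fin p → Bool) (hy : μ {ω | Y 0 ω = y} ≠ 0) (hyO : y ∈ O) : ∑ ab, m ab = 1 := by
    have := cond_isProbabilityMeasure
      (measure_ne_zero_of_pattern hy (q := fun y => y i = true ∧ y j = true) hyO)
    refine (h.sum_comp_P₂_castSucc hmiss (f := fun t => t) rfl i j).trans ?_
    simp only [h.sum_P₂, Psub]
    simpa using sum_measureReal_and_eq (ν := μ[|{ω | Y 0 ω i = true ∧ Y 0 ω j = true}])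
      (h.measurable_entry i) fun _ => True
  have hmem (y : Fin p → Bool) (hy : μ {ω | Y 0 ω = y} ≠ 0) (ab : Fin (α i) × Fin (α j)) :
      (outputLaw μ X Y y).real (B ab) = O.indicator (fun _ => m ab) y := by
    by_cases hyO : y ∈ O
    · rw [Set.indicator_of_mem hyO, h.outputLaw_real_apply]
      exact hij y hyO.1 hyO.2 hy _ _
    · rw [Set.indicator_of_notMem hyO]
      rcases not_and_or.1 hyO with hyi | hyj
      · exact h.outputLaw_real_eq_zero hmiss hyi fun s hs => hs.1 ▸ Fin.castSucc_ne_last ab.1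
      · exact h.outputLaw_real_eq_zero hmiss hyj fun s hs => hs.2 ▸ Fin.castSucc_ne_last ab.2
  have hbayes := h.exists_abs_integral_log_bayesMeasure_le hdisj hsum hmem
  rw [h.sum_comp_P₂_castSucc hmiss Real.negMulLog_zero, Fintype.card_prod, Fintype.card_fin,
    Fintype.card_fin, Nat.cast_mul] at hbayes
  simp only [Qpair_eq_bayesMeasure_hitCount, card_obs₂_eq_hitCount_iUnion_prod]
  exact hbayes

theorem exists_abs_integral_log_edge_le (hαi : 0 < α i) (hαj : 0 < α j)
    (h : IsMemorylessChannel μ X Y)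
    (hmiss : ∀ ω i, X 0 ω i = Fin.last (α i) ↔ Y 0 ω i = false) (hi : PatternFree μ X Y i i)
    (hj : PatternFree μ X Y j j) (hij : PatternFree μ X Y i j) :
    ∃ K : ℝ, ∀ n : ℕ, |∫ ω, Real.log (Qpair (frame X n ω) i j /
        (Qsub (frame X n ω) i j * Qsub (frame X n ω) j i)) ∂μ -
      n * (r₂ μ Y i j * I μ X Y i j) + ((α i : ℝ) - 1) * ((α j : ℝ) - 1) / 2 *
        ∫ ω, Real.log (obs₂ (frame X n ω) i j).card ∂μ| ≤ K := by
  have : Nonempty (Fin (α i)) := Fin.pos_iff_nonempty.1 hαi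
  have : Nonempty (Fin (α j)) := Fin.pos_iff_nonempty.1 hαj
  obtain ⟨K₁, hK₁⟩ := h.exists_abs_integral_log_Qpair_le hαi hαj hmiss hij
  obtain ⟨K₂, hK₂⟩ := h.exists_abs_integral_log_Qsub_le hαi hmiss hi j
  obtain ⟨K₃, hK₃⟩ := h.exists_abs_integral_log_Qsub_le hαj hmiss hj i
  refine ⟨K₁ + K₂ + K₃, fun n => ?_⟩
  have hlog (x : Fin n → Row α) : Real.log (Qpair x i j / (Qsub x i j * Qsub x j i)) =
      Real.log (Qpair x i j) - Real.log (Qsub x i j) - Real.log (Qsub x j i) := by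
    have hpair : Qpair x i j ≠ 0 := (bayesMeasure_pos _).ne'
    have hsub : Qsub x i j ≠ 0 := (bayesMeasure_pos _).ne'
    have hsub' : Qsub x j i ≠ 0 := (bayesMeasure_pos _).ne'
    rw [Real.log_div hpair (mul_ne_zero hsub hsub'), Real.log_mul hsub hsub', sub_sub]
  have hr : r₂ μ Y j i = r₂ μ Y i j := by simp only [r₂, and_comm]
  have hpair := abs_le.1 (hK₁ n)
  have hsub := abs_le.1 (hK₂ n)
  have hsub' := abs_le.1 (hK₃ n)
  simp only [obs₂_comm _ i j, hr] at hsub'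
  simp only [hlog]
  rw [integral_sub (h.integrable_frame fun x => Real.log (Qpair x i j) - Real.log (Qsub x i j))
      (h.integrable_frame fun x => Real.log (Qsub x j i)),
    integral_sub (h.integrable_frame fun x => Real.log (Qpair x i j))
      (h.integrable_frame fun x => Real.log (Qsub x i j)), h.r₂_mul_I_eq hi hj hij, abs_le]
  constructor <;> linarith [hpair.1, hpair.2, hsub.1, hsub.2, hsub'.1, hsub'.2]

theorem exists_abs_integral_descriptionLength_sub_le (hα : ∀ i, 0 < α i)
    (h : IsMemorylessChannel μ X Y)
    (hmiss : ∀ ω i, X 0 ω i = Fin.last (α i) ↔ Y 0 ω i = false) (hE : IsForest E)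
    (hV : ∀ i, PatternFree μ X Y i i) (hP : ∀ e ∈ E, PatternFree μ X Y e.1 e.2) :
    ∃ K : ℝ, ∀ n : ℕ, |∫ ω, descriptionLength (frame X n ω) E ∂μ -
      (n * condEntropy μ X Y E +
        ∑ i, ((α i : ℝ) - 1) / 2 * ∫ ω, Real.log (obs (frame X n ω) i).card ∂μ +
        ∑ e ∈ E, ((α e.1 : ℝ) - 1) * ((α e.2 : ℝ) - 1) / 2 *
          ∫ ω, Real.log (obs₂ (frame X n ω) e.1 e.2).card ∂μ)| ≤ K := by
  choose K₁ hK₁ using fun i => h.exists_abs_integral_log_Q_le (hα i) hmiss (hV i)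
  choose! K₂ hK₂ using fun e he =>
    h.exists_abs_integral_log_edge_le (hα e.1) (hα e.2) hmiss (hV _) (hV _) (hP e he)
  refine ⟨|Real.log (numForests p)| + ∑ i, K₁ i + ∑ e ∈ E, K₂ e, fun n => ?_⟩
  have hQ := (Finset.abs_sum_le_sum_abs _ _).trans
    (Finset.sum_le_sum fun i (_ : i ∈ Finset.univ) => hK₁ i n)
  have hedge := (Finset.abs_sum_le_sum_abs _ _).trans
    (Finset.sum_le_sum fun e he => hK₂ e he n)
  let logQ (i : Fin p) (x : Fin n → Row α) : ℝ := Real.log (Q x i)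
  let logEdge (e : Fin p × Fin p) (x : Fin n → Row α) : ℝ :=
    Real.log (Qpair x e.1 e.2 / (Qsub x e.1 e.2 * Qsub x e.2 e.1))
  have hlength : ∫ ω, descriptionLength (frame X n ω) E ∂μ = Real.log (numForests p) -
      (∑ i, ∫ ω, logQ i (frame X n ω) ∂μ + ∑ e ∈ E, ∫ ω, logEdge e (frame X n ω) ∂μ) := by
    simp only [descriptionLength, log_R hα]
    rw [integral_sub (integrable_const _) (h.integrable_frame fun x =>
        ∑ i, logQ i x + ∑ e ∈ E, logEdge e x), integral_const, probReal_univ, one_smul,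
      integral_add (h.integrable_frame fun x => ∑ i, logQ i x)
        (h.integrable_frame fun x => ∑ e ∈ E, logEdge e x),
      integral_finsetSum _ fun i _ => h.integrable_frame (logQ i),
      integral_finsetSum _ fun e _ => h.integrable_frame (logEdge e)]
  rw [hlength, h.condEntropy_eq hV hP hmiss hE]
  simp only [Finset.sum_add_distrib, Finset.sum_sub_distrib, ← Finset.mul_sum] at hQ hedge
  rw [abs_le] at hQ hedge ⊢
  have hforests := abs_le.1 (le_refl |Real.log (numForests p)|)
  constructor <;> linarith [hQ.1, hQ.2, hedge.1, hedge.2]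

theorem exists_integral_descriptionLength_le (hα : ∀ i, 0 < α i)
    (h : IsMemorylessChannel μ X Y)
    (hmiss : ∀ ω i, X 0 ω i = Fin.last (α i) ↔ Y 0 ω i = false) (hE : IsForest E)
    (hV : ∀ i, PatternFree μ X Y i i) (hP : ∀ e ∈ E, PatternFree μ X Y e.1 e.2)
    {E' : (n : ℕ) → (Fin n → Row α) → Finset (Fin p × Fin p)}
    (hE' : ∀ (n : ℕ) (x : Fin n → Row α), IsChowLiu (J x) (E' n x)) :
    ∃ C : ℝ, ∀ n : ℕ, 1 ≤ n →
      ∫ ω, descriptionLength (frame X n ω) (E' n (frame X n ω)) ∂μ ≤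
        n * condEntropy μ X Y E +
        ∑ i, ((α i : ℝ) - 1) / 2 * ∫ ω, Real.log (obs (frame X n ω) i).card ∂μ +
        ∑ e ∈ E, ((α e.1 : ℝ) - 1) * ((α e.2 : ℝ) - 1) / 2 *
          ∫ ω, Real.log (obs₂ (frame X n ω) e.1 e.2).card ∂μ + C := by
  obtain ⟨C, hC⟩ := h.exists_abs_integral_descriptionLength_sub_le hα hmiss hE hV hP
  refine ⟨C, fun n hn => ?_⟩
  have hmono := integral_mono (h.integrable_frame fun x => descriptionLength x (E' n x))
    (h.integrable_frame fun x => descriptionLength x E)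
    fun ω => (hE' n (frame X n ω)).descriptionLength_le hα hn hE
  exact hmono.trans (sub_le_iff_le_add'.1 (le_of_abs_le (hC n)))

end IsMemorylessChannel

end Redundancy

end ForestCoding

open ForestCoding in
theorem theorem2_general {p : ℕ} (α : Fin p → ℕ) (hα : ∀ i, 0 < α i)
    {Ω : Type*} [MeasurableSpace Ω] (μ : Measure Ω) [IsProbabilityMeasure μ]
    (X : ℕ → Ω → Row α) (Y : ℕ → Ω → Fin p → Bool) (hXY : IsMemorylessChannel μ X Y)
    (hmiss : ∀ ω i, X 0 ω i = Fin.last (α i) ↔ Y 0 ω i = false)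
    (E : Finset (Fin p × Fin p)) (hE : IsForest E)
    (E' : (n : ℕ) → (Fin n → Row α) → Finset (Fin p × Fin p))
    (hE' : ∀ (n : ℕ) (x : Fin n → Row α), IsChowLiu (J x) (E' n x))
    (hV : ∀ i, PatternFree μ X Y i i)
    (hP : ∀ e ∈ E, PatternFree μ X Y e.1 e.2) :
    condEntropy μ X Y E =
        ∑ i, r μ Y i * H μ X Y i - ∑ e ∈ E, r₂ μ Y e.1 e.2 * I μ X Y e.1 e.2 ∧
    ∃ C : ℝ, ∀ n : ℕ, 1 ≤ n →
      (∫ ω, descriptionLength (frame X n ω) (E' n (frame X n ω)) ∂μ) / n - condEntropy μ X Y E ≤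
        ∑ i, ((α i : ℝ) - 1) / (2 * n) * ∫ ω, Real.log ((obs (frame X n ω) i).card : ℝ) ∂μ +
        ∑ e ∈ E, (((α e.1 : ℝ) - 1) * ((α e.2 : ℝ) - 1)) / (2 * n) *
          ∫ ω, Real.log ((obs₂ (frame X n ω) e.1 e.2).card : ℝ) ∂μ +
        C / n := by
  refine ⟨hXY.condEntropy_eq hV hP hmiss hE, ?_⟩
  obtain ⟨C, hC⟩ := hXY.exists_integral_descriptionLength_le hα hmiss hE hV hP hE'
  refine ⟨C, fun n hn => ?_⟩
  have hpos : (0 : ℝ) < n := by exact_mod_cast hn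
  have hscale (a b : ℝ) : a / (2 * n) * b = a / 2 * b / n := by field_simp
  simp only [hscale, ← Finset.sum_div, ← add_div]
  rw [sub_le_iff_le_add, div_le_iff₀ hpos, add_mul, div_mul_cancel₀ _ hpos.ne']
  linarith [hC n hn]

open ForestCoding in
theorem theorem2 {p : ℕ} (α : Fin p → ℕ) (hα : ∀ i, 2 ≤ α i)
    {Ω : Type*} [MeasurableSpace Ω] (μ : Measure Ω) [IsProbabilityMeasure μ]
    (X : ℕ → Ω → Row α) (Y : ℕ → Ω → Fin p → Bool) (hXY : IsIncompleteSource μ X Y)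
    -- `E` is `E_{X|Y}`, `E' n x` is the `Jⁿ`-forest of the data frame `x`
    (E : Finset (Fin p × Fin p))
    (hE : IsChowLiu (fun i j => r₂ μ Y i j * I μ X Y i j) E)
    (E' : (n : ℕ) → (Fin n → Row α) → Finset (Fin p × Fin p))
    (hE' : ∀ (n : ℕ) (x : Fin n → Row α), IsChowLiu (J x) (E' n x))
    (hV : ∀ i, PatternFree μ X Y i i)
    (hP : ∀ e ∈ E, PatternFree μ X Y e.1 e.2) :
    condEntropy μ X Y E =
        ∑ i, r μ Y i * H μ X Y i - ∑ e ∈ E, r₂ μ Y e.1 e.2 * I μ X Y e.1 e.2 ∧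
    ∃ C : ℝ, ∀ n : ℕ, 1 ≤ n →
      (∫ ω, descriptionLength (frame X n ω) (E' n (frame X n ω)) ∂μ) / n - condEntropy μ X Y E ≤
        ∑ i, ((α i : ℝ) - 1) / (2 * n) * ∫ ω, Real.log ((obs (frame X n ω) i).card : ℝ) ∂μ +
        ∑ e ∈ E, (((α e.1 : ℝ) - 1) * ((α e.2 : ℝ) - 1)) / (2 * n) *
          ∫ ω, Real.log ((obs₂ (frame X n ω) e.1 e.2).card : ℝ) ∂μ +
        C / n :=
  theorem2_general α (fun i => two_pos.trans_le (hα i)) μ X Y hXY.isMemorylessChannel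
    (hXY.missing_iff 0) E hE.isForest E' hE' hV hP
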